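/- \textbf{Setting.} A battery with energy capacity $E>0$, charging and discharging efficiencies $\eta_c,\eta_d>0$, power rating $P$ and state-of-charge limits $\underline x\le x_0\le\overline x$ is operated over $T$ intervals of length $\tau>0$. Charging power $c_t$ and discharging power $d_t$, with $0\le c_t,d_t\le P$, give $$x_t=x_{t-1}+\frac{\tau\eta_c}{E}c_t-\frac{\tau}{\eta_dE}d_t,\qquad \underline x\le x_t\le\overline x\qquad(1\le t\le T).$$ The instruction signal is $r_t\in[-P,P]$, where $r_t>0$ asks for charging and $r_t<0$ for discharging. With prices $\theta,\pi\ge0$, a cell replacement cost $B>0$ and a cycle depth stress function $\Phi$, the cost of $(\mathbf c,\mathbf d)$ is $$J(\mathbf c,\mathbf d)=\tau\sum_{t=1}^T\Big(\theta\,[\,r_t-(c_t-d_t)]^++\pi\,[(c_t-d_t)-r_t]^+\Big)+EB\Big(\sum_i\tfrac{\Phi(v_i)}2+\sum_j\tfrac{\Phi(w_j)}2\Big),$$ where $v_i$ and $w_j$ are the depths of the charging and discharging half cycles that rainflow counting extracts from the profile $(x_0,x_1,\dots,x_T)$: among four successive local extrema $s_1,s_2,s_3,s_4$ (in chronological order),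 whenever $|s_2-s_3|\le|s_1-s_2|$ and $|s_2-s_3|\le|s_3-s_4|$, the points $s_2,s_3$ are removed and a full cycle (one charging and one discharging half cycle) of depth $|s_2-s_3|$ is recorded; when no such quadruple is left, any two consecutive remaining extrema form one half cycle. Let $J^*$ be the minimum of $J$, with all of $\mathbf r$ known, over the responses that satisfy the constraints above and do not exceed the instruction, that is, $0\le c_t\le[r_t]^+$ and $0\le d_t\le[-r_t]^+$. Suppose that $\Phi$ is differentiable, nondecreasing and strictly convex on $[0,\infty)$ with $\Phi(0)=0$, and that $\hat u\ge0$ solves $\Phi'(\hat u)=(\pi\eta_d+\theta/\eta_c)/B$ (one-sided derivative at $0$). The online threshold policy $g$ uses, in interval $t$, the current state of charge $x_{t-1}$ and its maximum $x^{\max}$ and minimum $x^{\min}$ over $x_0,\dots,x_{t-1}$: if $r_t\ge0$, then $c_t=\min\{\frac{E}{\tau\eta_c}(\min\{\overline x,x^{\min}+\hat u\}-x_{t-1}),\,r_t\}$ and $d_t=0$; if $r_t<0$, then $c_t=0$ and $d_t=\min\{\frac{E\eta_d}{\tau}(x_{t-1}-\max\{\underline x,x^{\max}-\hat u\}),\,-r_t\}$.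 Let $J_g$ be its cost. \textbf{Corollary (zero optimality gap).} If $\pi\eta_d=\theta/\eta_c$, then for every $T$ and every signal $\mathbf r$ the actions of $g$ satisfy all these constraints, the minimum $J^*$ exists, and $J_g=J^*$. In particular this holds if $\eta_d=1/\eta_c$ (equal efficiencies, in this notation) and $\theta=\pi$; in that case $J_g$ is also the minimum of $J$ over all $(\mathbf c,\mathbf d)$ with $0\le c_t,d_t\le P$ that satisfy the state-of-charge constraints, including responses that exceed the instruction. -/

import Mathlib

noncomputable section

namespace Storage

/-! ### Rainflow cycle counting -/

/-- Append a sample `z` to a list of turning points (newest first): a repeated value is ignored, and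
the newest point is overwritten when the profile keeps moving in the same direction. -/
def pushSample : List ℝ → ℝ → List ℝ
  | [], z => [z]
  | [q], z => if z = q then [q] else [z, q]
  | q :: p :: l, z =>
      if z = q then q :: p :: l
      else if (p < q ∧ q < z) ∨ (z < q ∧ q < p) then z :: p :: l
      else z :: q :: p :: l

/-- The local extrema `s₁, s₂, …` of a profile in chronological order, including its first and last
points. -/
def localExtrema (x : List ℝ) : List ℝ := (x.foldl pushSample []).reverse

/-- Four-point rule. The newest point is `s₄`, the list holds the earlier ones, newest first. As long
as the middle range `|s₂ - s₃|` is at most both adjacent ranges, the full cycle `s₂`-`s₃` is extracted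
and `s₂`, `s₃` are discarded. Returns the depths of the extracted full cycles and the
remaining points, newest first. -/
def collapse (s₄ : ℝ) : List ℝ → List ℝ × List ℝ
  | s₃ :: s₂ :: s₁ :: l =>
      if |s₂ - s₃| ≤ |s₁ - s₂| ∧ |s₂ - s₃| ≤ |s₃ - s₄| then
        (|s₂ - s₃| :: (collapse s₄ (s₁ :: l)).1, (collapse s₄ (s₁ :: l)).2)
      else ([], s₄ :: s₃ :: s₂ :: s₁ :: l)
  | l => ([], s₄ :: l)

/-- One pass over the extrema. Returns the depths of the full cycles and the residue (newest first). -/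
def scan : List ℝ → List ℝ → List ℝ × List ℝ
  | stack, [] => ([], stack)
  | stack, s :: l =>
      ((collapse s stack).1 ++ (scan (collapse s stack).2 l).1, (scan (collapse s stack).2 l).2)

/-- Depths of the rises between consecutive points. -/
def rises : List ℝ → List ℝ
  | a :: b :: l => if a < b then (b - a) :: rises (b :: l) else rises (b :: l)
  | _ => []

/-- Depths of the falls between consecutive points. -/
def falls : List ℝ → List ℝ
  | a :: b :: l => if b < a then (a - b) :: falls (b :: l) else falls (b :: l)
  | _ => []

/-- `rainflow x = (v, w)`: the depths of the charging half cycles `v` and of the discharging half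
cycles `w` of the profile `x`. A full cycle is one charging and one discharging half cycle; any two
consecutive points of the residue form a half cycle. -/
def rainflow (x : List ℝ) : List ℝ × List ℝ :=
  let p := scan [] (localExtrema x)
  (p.1 ++ rises p.2.reverse, p.1 ++ falls p.2.reverse)

/-- Life loss of a profile: half the stress `Φ` of every half cycle. -/
def lifeLoss (Φ : ℝ → ℝ) (x : List ℝ) : ℝ :=
  ((rainflow x).1.map fun u => Φ u / 2).sum + ((rainflow x).2.map fun u => Φ u / 2).sum

/-! ### The storage model -/

/-- The data of the control problem. -/
structure Model where
  /-- length of a control interval -/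
  τ : ℝ
  /-- energy capacity -/
  E : ℝ
  /-- charging efficiency -/
  ηc : ℝ
  /-- discharging efficiency -/
  ηd : ℝ
  /-- power rating -/
  P : ℝ
  /-- lower limit of the state of charge -/
  xlo : ℝ
  /-- upper limit of the state of charge -/
  xhi : ℝ
  /-- initial state of charge -/
  x₀ : ℝ
  /-- cell replacement unit cost -/
  B : ℝ
  /-- price for surplus injections or deficient demands -/
  θ : ℝ
  /-- price for deficient injections or surplus demands -/
  π : ℝ
  /-- cycle depth stress function -/
  Φ : ℝ → ℝ

namespace Model

variable (m : Model)

/-- State of charge after one control interval with charging power `c` and discharging power `d`. -/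
def step (x c d : ℝ) : ℝ := x + m.τ * m.ηc / m.E * c - m.τ / (m.ηd * m.E) * d

/-- State of charge before interval `t` (intervals are numbered `0, 1, …, T - 1`). -/
def soc (c d : ℕ → ℝ) : ℕ → ℝ
  | 0 => m.x₀
  | t + 1 => m.step (soc c d t) (c t) (d t)

/-- Penalty in one interval for net charging power `c - d` under the instruction `r`, where `r > 0`
instructs to charge and `r < 0` to discharge. -/
def penalty (r c d : ℝ) : ℝ :=
  m.τ * (m.θ * max (r - (c - d)) 0 + m.π * max ((c - d) - r) 0)

/-- Total operating cost over `T` intervals: penalties plus rainflow degradation cost of the profile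
`x₀, x₁, …, x_T`. -/
def cost (T : ℕ) (r c d : ℕ → ℝ) : ℝ :=
  ∑ t ∈ Finset.range T, m.penalty (r t) (c t) (d t)
    + lifeLoss m.Φ ((List.range (T + 1)).map (m.soc c d)) * m.B * m.E

/-- The power constraints and the limits on the state of charge. -/
def Feasible (T : ℕ) (c d : ℕ → ℝ) : Prop :=
  ∀ t < T, (0 ≤ c t ∧ c t ≤ m.P) ∧ (0 ≤ d t ∧ d t ≤ m.P) ∧
    (m.xlo ≤ m.soc c d (t + 1) ∧ m.soc c d (t + 1) ≤ m.xhi)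

/-- Feasible responses whose actions never exceed the instruction signal:
`0 ≤ c_t ≤ [r_t]⁺` and `0 ≤ d_t ≤ [-r_t]⁺`. -/
def FeasibleWithin (T : ℕ) (r c d : ℕ → ℝ) : Prop :=
  m.Feasible T c d ∧ ∀ t < T, c t ≤ max (r t) 0 ∧ d t ≤ max (-r t) 0

/-- Costs of all responses that never exceed the instruction signal. -/
def costsWithin (T : ℕ) (r : ℕ → ℝ) : Set ℝ :=
  {J | ∃ c d : ℕ → ℝ, m.FeasibleWithin T r c d ∧ J = m.cost T r c d}

/-- Costs of all feasible responses, over-response and simultaneous charging and discharging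
included. -/
def costs (T : ℕ) (r : ℕ → ℝ) : Set ℝ :=
  {J | ∃ c d : ℕ → ℝ, m.Feasible T c d ∧ J = m.cost T r c d}

/-- The offline optimal cost `J*`. -/
def offlineCost (T : ℕ) (r : ℕ → ℝ) : ℝ := sInf (m.costsWithin T r)

/-! ### The online threshold policy -/

/-- The marginal value `(π η_d + θ / η_c) / B`. -/
def marginal : ℝ := (m.π * m.ηd + m.θ / m.ηc) / m.B

/-- The threshold `û`: the inverse, on depths `u ≥ 0`, of the derivative of `Φ` at `marginal`. -/
def uhat : ℝ :=
  Function.invFunOn (derivWithin m.Φ (Set.Ici 0)) (Set.Ici 0) m.marginal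

/-- What the controller remembers: current state of charge and its running maximum and minimum. -/
structure ControllerState where
  /-- current state of charge -/
  x : ℝ
  /-- running maximum -/
  xmax : ℝ
  /-- running minimum -/
  xmin : ℝ

/-- Charging and discharging power chosen by the controller on reading the instruction `r`. -/
def action (s : ControllerState) (r : ℝ) : ℝ × ℝ :=
  if 0 ≤ r then
    (min (m.E / (m.τ * m.ηc) * (min m.xhi (s.xmin + m.uhat) - s.x)) r, 0)
  else
    (0, min (m.E * m.ηd / m.τ * (s.x - max m.xlo (s.xmax - m.uhat))) (-r))

/-- Controller state before interval `t`; it depends on `r 0, …, r (t - 1)` only. -/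
def controller (r : ℕ → ℝ) : ℕ → ControllerState
  | 0 => ⟨m.x₀, m.x₀, m.x₀⟩
  | t + 1 =>
      let s := controller r t
      let y := m.step s.x (m.action s (r t)).1 (m.action s (r t)).2
      ⟨y, max s.xmax y, min s.xmin y⟩

/-- Charging powers of the threshold policy. -/
def policyC (r : ℕ → ℝ) (t : ℕ) : ℝ := (m.action (m.controller r t) (r t)).1

/-- Discharging powers of the threshold policy. -/
def policyD (r : ℕ → ℝ) (t : ℕ) : ℝ := (m.action (m.controller r t) (r t)).2

/-- The cost `J_g` of the threshold policy. -/
def policyCost (T : ℕ) (r : ℕ → ℝ) : ℝ := m.cost T r (m.policyC r) (m.policyD r)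

end Model

end Storage

end

/-! ### The stop automaton -/

/-! For a width `s`, let a stop follow the profile: a point that copies its moves but is held in a
window of length `s`. The variation of this point is the sum of `min u s` over the rainflow half
cycles `u` (`sum_min_halfCycles`). Indeed, extracting a full cycle of depth `u` removes an excursion
there and back that contributes `2 * min u s`, and in the residue the ranges first grow and then
shrink, so that the stop always has room for `min u s`. Rainflow counting is thereby encoded by
automata that read the profile in order of time.

Put `q = π η_d / B`. Under the price condition a missing unit of state of charge costs `E B q` in
both directions, and `Φ'(û) = 2 q`. Up to a common constant and the factor `E B`, the cost of a
response is `q W - ∑ g u` over its half cycles, with `g u = q u - Φ u / 2`; here `W` sums `|a - δ| +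
|δ| - |a|` over the intervals, `a` being the change asked for and `δ` the change made. The policy
has `W = 0`.

The function `g` is concave, increases up to `û`, where it is maximal, and satisfies `g u ≤ q u`.
The depths of the policy never exceed `û`, and cutting those of a competitor at `û` only helps the
competitor. At the finitely many depths that occur, `g` is then a nonnegative combination of
functions `min · s` with `s ≤ û` and total weight at most `q` (`sum_map_le_of_sum_min_le`). So it
suffices that, for each `s ≤ û`, the variation of the stop along the competitor exceeds that along
the policy by at most `W`. The invariant `Ahead` carries this through time (`ahead_controller`): the
policy falls short of the instruction only at a limit of the state of charge, or at its threshold,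
and there a stop of width `s ≤ û` is saturated as well. -/

/-- State of a stop (two-sided reflection) of width `s`: the room left below and above the current
position, and the variation accumulated so far. -/
@[ext] structure StopState where
  /-- room below -/
  lo : ℝ
  /-- room above -/
  hi : ℝ
  /-- accumulated variation -/
  gain : ℝ

namespace StopState

/-- Initial state: nothing has been visited yet. -/
def init (s : ℝ) : StopState := ⟨s, s, 0⟩

/-- Move by `δ`, stopped at the ends of the admissible window; as long as the visited range is
shorter than `s`, the window is not yet determined. -/
noncomputable def step (s δ : ℝ) (σ : StopState) : StopState :=
  ⟨min (σ.lo + max (-σ.lo) (min δ σ.hi)) s, min (σ.hi - max (-σ.lo) (min δ σ.hi)) s,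
    σ.gain + |max (-σ.lo) (min δ σ.hi)|⟩

/-- The state seen upside down. -/
def swap (σ : StopState) : StopState := ⟨σ.hi, σ.lo, σ.gain⟩

/-- The state after adding `g` to the accumulated variation. -/
def addGain (g : ℝ) (σ : StopState) : StopState := ⟨σ.lo, σ.hi, σ.gain + g⟩

/-- The constraints satisfied by all reachable states. -/
structure Valid (s : ℝ) (σ : StopState) : Prop where
  lo_nonneg : 0 ≤ σ.lo
  lo_le : σ.lo ≤ s
  hi_nonneg : 0 ≤ σ.hi
  hi_le : σ.hi ≤ s
  le_add : s ≤ σ.lo + σ.hi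

variable {s : ℝ} {σ : StopState}

theorem valid_init (hs : 0 ≤ s) : Valid s (init s) :=
  ⟨hs, le_rfl, hs, le_rfl, le_add_of_nonneg_left hs⟩

theorem Valid.swap (h : Valid s σ) : Valid s σ.swap :=
  ⟨h.hi_nonneg, h.hi_le, h.lo_nonneg, h.lo_le, by
    have := h.le_add; simp only [StopState.swap]; linarith⟩

theorem Valid.addGain (h : Valid s σ) (g : ℝ) : Valid s (σ.addGain g) :=
  ⟨h.lo_nonneg, h.lo_le, h.hi_nonneg, h.hi_le, h.le_add⟩

theorem swap_swap (σ : StopState) : σ.swap.swap = σ := rfl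

theorem step_addGain (δ g : ℝ) : step s δ (σ.addGain g) = (step s δ σ).addGain g := by
  simp only [step, addGain, StopState.mk.injEq, true_and]
  ring

/-- Reduces downward moves to upward ones. Validity is needed because the two clamps commute only if
`-σ.lo ≤ σ.hi`. -/
theorem Valid.step_swap (h : Valid s σ) (δ : ℝ) :
    step s (-δ) σ.swap = (step s δ σ).swap := by
  have h1 := h.lo_nonneg
  have h2 := h.hi_nonneg
  have key : max (-σ.hi) (min (-δ) σ.lo) = -max (-σ.lo) (min δ σ.hi) := by
    grind
  simp only [StopState.step, StopState.swap, key, abs_neg, sub_neg_eq_add, StopState.mk.injEq, and_true]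
  rw [sub_eq_add_neg]

theorem Valid.step_of_nonneg (h : Valid s σ) {δ : ℝ} (hδ : 0 ≤ δ) :
    step s δ σ = ⟨min (σ.lo + min δ σ.hi) s, σ.hi - min δ σ.hi, σ.gain + min δ σ.hi⟩ := by
  obtain ⟨h1, h2, h3, h4, h5⟩ := h
  have h0 : 0 ≤ min δ σ.hi := le_min hδ h3
  have key : max (-σ.lo) (min δ σ.hi) = min δ σ.hi := max_eq_right (by linarith)
  simp only [StopState.step, key, abs_of_nonneg h0, StopState.mk.injEq, true_and, and_true]
  exact min_eq_left (by linarith)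

theorem Valid.step_of_nonneg_le (h : Valid s σ) {δ : ℝ} (hδ : 0 ≤ δ) (hle : δ ≤ σ.hi) :
    step s δ σ = ⟨min (σ.lo + δ) s, σ.hi - δ, σ.gain + δ⟩ := by
  rw [h.step_of_nonneg hδ, min_eq_left hle]

theorem Valid.step_of_hi_le (h : Valid s σ) {δ : ℝ} (hle : σ.hi ≤ δ) :
    step s δ σ = ⟨s, 0, σ.gain + σ.hi⟩ := by
  rw [h.step_of_nonneg (h.hi_nonneg.trans hle), min_eq_right hle, sub_self,
    min_eq_right h.le_add]

theorem Valid.step_neg (h : Valid s σ) (δ : ℝ) : step s (-δ) σ = (step s δ σ.swap).swap := by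
  rw [← h.swap.step_swap, swap_swap]

theorem Valid.step_zero (h : Valid s σ) : step s 0 σ = σ := by
  rw [h.step_of_nonneg_le le_rfl h.hi_nonneg]
  ext <;> simp [h.lo_le]

theorem Valid.step_valid_of_nonneg (h : Valid s σ) {δ : ℝ} (hδ : 0 ≤ δ) :
    Valid s (step s δ σ) := by
  obtain ⟨h1, h2, h3, h4, h5⟩ := h
  rcases le_total δ σ.hi with hle | hle
  · rw [Valid.step_of_nonneg_le ⟨h1, h2, h3, h4, h5⟩ hδ hle]
    refine ⟨le_min (by linarith) (by linarith), min_le_right _ _, by simpa using hle,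
      by dsimp only; linarith, ?_⟩
    dsimp only
    rcases min_choice (σ.lo + δ) s with h | h <;> rw [h] <;> linarith
  · rw [Valid.step_of_hi_le ⟨h1, h2, h3, h4, h5⟩ hle]
    exact ⟨by dsimp only; linarith, le_rfl, le_rfl, by dsimp only; linarith, by simp⟩

theorem Valid.step (h : Valid s σ) (δ : ℝ) : Valid s (step s δ σ) := by
  rcases le_total 0 δ with hδ | hδ
  · exact h.step_valid_of_nonneg hδ
  · rw [← neg_neg δ, h.step_neg]
    exact (h.swap.step_valid_of_nonneg (by linarith)).swap

/-- Once the stop is saturated, further motion in the same direction has no effect, so only the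
total of a monotone stretch matters. This is why samples between turning points can be dropped. -/
theorem Valid.step_add_of_nonneg (h : Valid s σ) {δ ε : ℝ} (hδ : 0 ≤ δ) (hε : 0 ≤ ε) :
    StopState.step s (δ + ε) σ = StopState.step s ε (StopState.step s δ σ) := by
  have hv := h.step δ
  obtain ⟨h1, h2, h3, h4, h5⟩ := id h
  rcases le_total δ σ.hi with hle | hle
  · have e1 := h.step_of_nonneg_le hδ hle
    rcases le_total ε (σ.hi - δ) with hle' | hle'
    · rw [h.step_of_nonneg_le (by linarith) (by linarith),
        hv.step_of_nonneg_le hε (by rw [e1]; exact hle'), e1]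
      ext
      · dsimp only
        grind
      · dsimp only
        ring
      · dsimp only
        ring
    · rw [h.step_of_hi_le (by linarith), hv.step_of_hi_le (by rw [e1]; exact hle'), e1]
      simp
  · have e1 := h.step_of_hi_le hle
    rw [h.step_of_hi_le (by linarith), hv.step_of_hi_le (by rw [e1]; exact hε), e1]
    simp

theorem Valid.step_add_of_nonpos (h : Valid s σ) {δ ε : ℝ} (hδ : δ ≤ 0) (hε : ε ≤ 0) :
    StopState.step s (δ + ε) σ = StopState.step s ε (StopState.step s δ σ) := by
  have := h.swap.step_add_of_nonneg (neg_nonneg.2 hδ) (neg_nonneg.2 hε)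
  rw [← neg_add, h.step_swap, h.step_swap, (h.step δ).step_swap] at this
  rw [← swap_swap (StopState.step s (δ + ε) σ), this, swap_swap]

/-- A back-and-forth move of depth `u` inside a larger move contributes `2 * min u s`. -/
theorem Valid.step_cycle_of_nonneg (h : Valid s σ) {u : ℝ} (hu : 0 ≤ u) :
    StopState.step s u (StopState.step s (-u) (StopState.step s u σ)) =
      (StopState.step s u σ).addGain (2 * min u s) := by
  have hv := h.step u
  have hvv := hv.step (-u)
  obtain ⟨h1, h2, h3, h4, h5⟩ := id h
  rcases le_total u σ.hi with hle | hle
  · have e1 := h.step_of_nonneg_le hu hle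
    have hus : u ≤ s := hle.trans h4
    have hua : u ≤ min (σ.lo + u) s := le_min (by linarith) hus
    have e2 : StopState.step s (-u) (StopState.step s u σ) =
        ⟨min (σ.lo + u) s - u, min (σ.hi - u + u) s, σ.gain + u + u⟩ := by
      rw [hv.step_neg, hv.swap.step_of_nonneg_le hu (by rw [e1]; exact hua), e1]
      rfl
    rw [hvv.step_of_nonneg_le hu (by rw [e2]; simp [hle, hus]), e2, e1]
    ext
    · simp [StopState.addGain]
    · simp [StopState.addGain, h4]
    · simp only [StopState.addGain, min_eq_left hus]
      ring
  · have e1 := h.step_of_hi_le hle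
    have e2 : StopState.step s (-u) (StopState.step s u σ) =
        ⟨s - min u s, min u s, σ.gain + σ.hi + min u s⟩ := by
      rw [hv.step_neg, hv.swap.step_of_nonneg hu, e1]
      simp [StopState.swap]
    rw [hvv.step_of_hi_le (by rw [e2]; exact min_le_left _ _), e2, e1]
    ext
    · simp [StopState.addGain]
    · simp [StopState.addGain]
    · simp only [StopState.addGain]
      ring

/-- Splitting `u₁ = (u₁ - u₂) + u₂` and `u₃ = u₂ + (u₃ - u₂)` isolates the moves `u₂, -u₂, u₂` in
the middle, to which `step_cycle_of_nonneg` applies. -/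
theorem Valid.step_four_point_of_nonneg (h : Valid s σ) {u₁ u₂ u₃ : ℝ} (h2 : 0 ≤ u₂)
    (h1 : u₂ ≤ u₁) (h3 : u₂ ≤ u₃) :
    StopState.step s u₃ (StopState.step s (-u₂) (StopState.step s u₁ σ)) =
      (StopState.step s (u₁ - u₂ + u₃) σ).addGain (2 * min u₂ s) := by
  have hv := h.step (u₁ - u₂)
  have e1 : u₁ = (u₁ - u₂) + u₂ := by ring
  have e3 : u₃ = u₂ + (u₃ - u₂) := by ring
  have e : u₁ - u₂ + u₃ = (u₁ - u₂) + (u₂ + (u₃ - u₂)) := by ring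
  rw [e, h.step_add_of_nonneg (sub_nonneg.2 h1) (by linarith),
    hv.step_add_of_nonneg h2 (sub_nonneg.2 h3), ← step_addGain, ← hv.step_cycle_of_nonneg h2,
    ← ((hv.step u₂).step (-u₂)).step_add_of_nonneg h2 (sub_nonneg.2 h3), ← e3,
    ← h.step_add_of_nonneg (sub_nonneg.2 h1) h2, ← e1]

end StopState

/-! ### Rainflow counting and the stop automaton

Lists of turning points have the newest point first, as in `Storage.collapse`. -/

namespace StopState

variable {s : ℝ}

/-- The state after following a profile, given with its newest value first. -/
noncomputable def run (s : ℝ) : List ℝ → StopState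
  | z :: q :: l => step s (z - q) (run s (q :: l))
  | _ => init s

theorem valid_run (hs : 0 ≤ s) : ∀ L, Valid s (run s L)
  | [] => valid_init hs
  | [_] => valid_init hs
  | z :: q :: l => (valid_run hs (q :: l)).step (z - q)

theorem run_cons_addGain {A B : List ℝ} {g : ℝ} (hh : A.head? = B.head?) (hA : A ≠ [])
    (h : run s A = (run s B).addGain g) (z : ℝ) :
    run s (z :: A) = (run s (z :: B)).addGain g := by
  cases A with
  | nil => exact absurd rfl hA
  | cons a A =>
    cases B with
    | nil => simp at hh
    | cons b B =>
      obtain rfl : a = b := by simpa using hh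
      simp only [run, h, step_addGain]

/-- The accumulated variation never influences the motion, and later moves see the past only through
the newest point and the state. -/
theorem run_append_addGain {A B : List ℝ} {g : ℝ} (hh : A.head? = B.head?) (hA : A ≠ [])
    (h : run s A = (run s B).addGain g) (M : List ℝ) :
    run s (M ++ A) = (run s (M ++ B)).addGain g := by
  induction M with
  | nil => exact h
  | cons z M ih =>
    refine run_cons_addGain ?_ (by simp [hA]) ih z
    cases M with
    | nil => exact hh
    | cons => rfl

theorem run_cons_congr {A B : List ℝ} (hh : A.head? = B.head?) (h : run s A = run s B) (z : ℝ) :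
    run s (z :: A) = run s (z :: B) := by
  cases A <;> cases B <;> simp_all [run]

end StopState

namespace Storage

open StopState

variable {s : ℝ}

/-- Consecutive points are distinct and every inner point is a strict turning point. -/
def Zigzag : List ℝ → Prop
  | z :: q :: p :: l => (p < q ∧ z < q ∨ q < p ∧ q < z) ∧ Zigzag (q :: p :: l)
  | [z, q] => z ≠ q
  | _ => True

/-- No four consecutive points satisfy the four-point rule. -/
def Irreducible : List ℝ → Prop
  | s₄ :: s₃ :: s₂ :: s₁ :: l =>
      ¬(|s₂ - s₃| ≤ |s₁ - s₂| ∧ |s₂ - s₃| ≤ |s₃ - s₄|) ∧ Irreducible (s₃ :: s₂ :: s₁ :: l)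
  | _ => True

theorem Zigzag.tail : ∀ {z : ℝ} {L : List ℝ}, Zigzag (z :: L) → Zigzag L
  | _, [], _ => trivial
  | _, [_], _ => trivial
  | _, _ :: _ :: _, h => h.2

theorem Zigzag.of_append : ∀ (M : List ℝ) {L : List ℝ}, Zigzag (M ++ L) → Zigzag L
  | [], _, h => h
  | _ :: M, _, h => Zigzag.of_append M h.tail

theorem Zigzag.ne : ∀ {z q : ℝ} {L : List ℝ}, Zigzag (z :: q :: L) → z ≠ q
  | _, _, [], h => h
  | _, _, _ :: _, h => by
    rcases h.1 with h | h
    · exact h.2.ne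
    · exact h.2.ne'

theorem Irreducible.tail : ∀ {z : ℝ} {L : List ℝ}, Irreducible (z :: L) → Irreducible L
  | _, [], _ => trivial
  | _, [_], _ => trivial
  | _, [_, _], _ => trivial
  | _, _ :: _ :: _ :: _, h => h.2

/-! ### Passing from samples to turning points -/

theorem pushSample_head? (L : List ℝ) (z : ℝ) : (pushSample L z).head? = some z := by
  fun_cases pushSample L z <;> simp_all

theorem run_pushSample (hs : 0 ≤ s) (z : ℝ) : ∀ L, run s (pushSample L z) = run s (z :: L)
  | [] => rfl
  | [q] => by
    rw [pushSample]
    split_ifs with h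
    · simp [run, h, (valid_init hs).step_zero]
    · rfl
  | q :: p :: l => by
    rw [pushSample]
    split_ifs with h1 h2
    · rw [h1, run.eq_1 s q q, sub_self, (valid_run hs _).step_zero]
    · have hv := valid_run hs (p :: l)
      rw [run, run, run, show z - p = (q - p) + (z - q) by ring]
      rcases h2 with h2 | h2
      · exact hv.step_add_of_nonneg (by linarith) (by linarith)
      · exact hv.step_add_of_nonpos (by linarith) (by linarith)
    · rfl

theorem zigzag_pushSample (z : ℝ) : ∀ {L : List ℝ}, Zigzag L → Zigzag (pushSample L z)
  | [], _ => trivial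
  | [q], _ => by
    rw [pushSample]
    split_ifs with h
    · trivial
    · exact h
  | q :: p :: l, h => by
    rw [pushSample]
    split_ifs with h1 h2
    · exact h
    · cases l with
      | nil =>
        rcases h2 with h2 | h2
        · exact (h2.1.trans h2.2).ne'
        · exact (h2.1.trans h2.2).ne
      | cons o l =>
        refine ⟨?_, h.2⟩
        have := h.1
        grind
    · refine ⟨?_, h⟩
      have := h.ne
      grind

theorem run_foldl_pushSample (hs : 0 ≤ s) (x : List ℝ) {L R : List ℝ} (hh : L.head? = R.head?)
    (h : run s L = run s R) : run s (x.foldl pushSample L) = run s (x.reverse ++ R) := by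
  induction x generalizing L R with
  | nil => exact h
  | cons z x ih =>
    rw [List.foldl_cons, List.reverse_cons, List.append_assoc]
    refine ih (pushSample_head? L z) ?_
    rw [run_pushSample hs]
    exact run_cons_congr hh h z

theorem zigzag_foldl_pushSample (x : List ℝ) {L : List ℝ} (h : Zigzag L) :
    Zigzag (x.foldl pushSample L) := by
  induction x generalizing L with
  | nil => exact h
  | cons z x ih => exact ih (zigzag_pushSample z h)

/-- The points of `M` depend on what lies beneath `a` only through the side of `a` on which its
neighbour lies, and `hd` preserves that side. -/
theorem Zigzag.append_congr {a b c : ℝ} {L L' : List ℝ} (h' : Zigzag (a :: c :: L'))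
    (hd : b < a ↔ c < a) : ∀ M : List ℝ, Zigzag (M ++ a :: b :: L) → Zigzag (M ++ a :: c :: L')
  | [], _ => h'
  | [m], h => by
    refine ⟨?_, h'⟩
    have h1 := h.1
    have h2 := h'.ne
    grind
  | [_, _], h => ⟨h.1, Zigzag.append_congr h' hd [_] h.2⟩
  | _ :: m :: k :: M, h => ⟨h.1, Zigzag.append_congr h' hd (m :: k :: M) h.2⟩

/-! ### The four-point rule -/

theorem collapse_head? (s₄ : ℝ) (L : List ℝ) : (collapse s₄ L).2.head? = some s₄ := by
  fun_induction collapse s₄ L <;> simp_all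

/-- The facts about a four-point configuration extracted from a zigzag. -/
theorem Zigzag.four_point {s₁ s₂ s₃ s₄ : ℝ} {l : List ℝ} (hz : Zigzag (s₄ :: s₃ :: s₂ :: s₁ :: l))
    (h : |s₂ - s₃| ≤ |s₁ - s₂| ∧ |s₂ - s₃| ≤ |s₃ - s₄|) :
    (s₁ < s₂ ∧ s₃ < s₂ ∧ s₃ < s₄ ∧ s₁ ≤ s₃ ∧ s₂ ≤ s₄) ∨
      (s₂ < s₁ ∧ s₂ < s₃ ∧ s₄ < s₃ ∧ s₃ ≤ s₁ ∧ s₄ ≤ s₂) := by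
  have h1 := hz.1
  have h2 := hz.2.1
  obtain ⟨h3, h4⟩ := h
  rcases h1 with h1 | h1
  · right
    have : s₂ < s₁ := by grind
    rw [abs_of_neg (by linarith), abs_of_pos (by linarith)] at h3
    rw [abs_of_neg (by linarith), abs_of_pos (by linarith)] at h4
    refine ⟨this, h1.1, h1.2, ?_, ?_⟩ <;> linarith
  · left
    have : s₁ < s₂ := by grind
    rw [abs_of_pos (by linarith), abs_of_neg (by linarith)] at h3
    rw [abs_of_pos (by linarith), abs_of_neg (by linarith)] at h4
    refine ⟨this, h1.1, h1.2, ?_, ?_⟩ <;> linarith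

/-- The middle range lies between `s₁` and `s₄`, so `s₁` is on the same side of `s₄` as the removed
`s₃`, and `s₄` on the same side of `s₁` as the removed `s₂`. -/
theorem Zigzag.remove_inner {s₁ s₂ s₃ s₄ : ℝ} {l : List ℝ}
    (h : |s₂ - s₃| ≤ |s₁ - s₂| ∧ |s₂ - s₃| ≤ |s₃ - s₄|) (M : List ℝ)
    (hz : Zigzag (M ++ s₄ :: s₃ :: s₂ :: s₁ :: l)) : Zigzag (M ++ s₄ :: s₁ :: l) := by
  have hz' := Zigzag.of_append M hz
  have h4 := hz'.four_point h
  refine Zigzag.append_congr ?_ ?_ M hz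
  · have h0 := hz'.2.2
    cases l with
    | nil =>
      change s₄ ≠ s₁
      rcases h4 with h4 | h4
      · exact (by linarith : s₁ < s₄).ne'
      · exact (by linarith : s₄ < s₁).ne
    | cons o l =>
      refine ⟨?_, h0.2⟩
      have := h0.1
      grind
  · grind

theorem run_remove_inner (hs : 0 ≤ s) {s₁ s₂ s₃ s₄ : ℝ} {l : List ℝ}
    (hz : Zigzag (s₄ :: s₃ :: s₂ :: s₁ :: l))
    (h : |s₂ - s₃| ≤ |s₁ - s₂| ∧ |s₂ - s₃| ≤ |s₃ - s₄|) :
    run s (s₄ :: s₃ :: s₂ :: s₁ :: l) =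
      (run s (s₄ :: s₁ :: l)).addGain (2 * min |s₂ - s₃| s) := by
  have hv := valid_run hs (s₁ :: l)
  rcases hz.four_point h with h4 | h4
  · have := hv.step_four_point_of_nonneg (u₁ := s₂ - s₁) (u₂ := s₂ - s₃) (u₃ := s₄ - s₃)
      (by linarith) (by linarith) (by linarith)
    rw [neg_sub, show s₂ - s₁ - (s₂ - s₃) + (s₄ - s₃) = s₄ - s₁ by ring] at this
    rw [run, run, run, run, abs_of_pos (by linarith), this]
  · have := hv.swap.step_four_point_of_nonneg (u₁ := s₁ - s₂) (u₂ := s₃ - s₂) (u₃ := s₃ - s₄)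
      (by linarith) (by linarith) (by linarith)
    rw [← neg_sub s₂ s₁, hv.step_swap, (hv.step _).step_swap, ← neg_sub s₄ s₃,
      ((hv.step _).step _).step_swap,
      show -(s₂ - s₁) - (s₃ - s₂) + -(s₄ - s₃) = -(s₄ - s₁) by ring, hv.step_swap] at this
    rw [run, run, run, run, abs_of_neg (by linarith), neg_sub, ← swap_swap (StopState.step _ _ _),
      this]
    rfl

theorem addGain_addGain (σ : StopState) (g g' : ℝ) :
    (σ.addGain g).addGain g' = σ.addGain (g + g') := by
  simp [addGain, add_assoc]

/-- Effect of one pass of the four-point rule on the stop automaton. -/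
theorem collapse_spec (hs : 0 ≤ s) (s₄ : ℝ) (L : List ℝ) (hi : Irreducible L)
    (hz : Zigzag (s₄ :: L)) :
    run s (s₄ :: L) = (run s (collapse s₄ L).2).addGain
        (2 * ((collapse s₄ L).1.map fun u => min u s).sum) ∧
      Irreducible (collapse s₄ L).2 ∧
      ∀ M, Zigzag (M ++ s₄ :: L) → Zigzag (M ++ (collapse s₄ L).2) := by
  fun_induction collapse s₄ L with
  | case1 s₃ s₂ s₁ l h ih =>
    obtain ⟨ih1, ih2, ih3⟩ := ih hi.tail.tail (Zigzag.remove_inner h [] hz)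
    refine ⟨?_, ih2, fun M hM => ih3 M (Zigzag.remove_inner h M hM)⟩
    rw [run_remove_inner hs hz h, ih1, addGain_addGain, List.map_cons, List.sum_cons]
    congr 1
    ring
  | case2 s₃ s₂ s₁ l h =>
    exact ⟨by simp [addGain], ⟨h, hi⟩, fun M hM => hM⟩
  | case3 L hL =>
    refine ⟨by simp [addGain], ?_, fun M hM => hM⟩
    match L, hL with
    | [], _ => trivial
    | [_], _ => trivial
    | [_, _], _ => trivial
    | a :: b :: c :: l, hL => exact absurd rfl (hL a b c l)

/-- The zigzag hypothesis includes the points not yet read, since an extraction must leave them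
turning points; for this `collapse_spec` quantifies over `M`. -/
theorem scan_spec (hs : 0 ≤ s) (l L : List ℝ) (hi : Irreducible L)
    (hz : Zigzag (l.reverse ++ L)) :
    run s (l.reverse ++ L) = (run s (scan L l).2).addGain
        (2 * ((scan L l).1.map fun u => min u s).sum) ∧
      Irreducible (scan L l).2 ∧ Zigzag (scan L l).2 := by
  induction l generalizing L with
  | nil => exact ⟨by simp [scan, addGain], hi, hz⟩
  | cons z l ih =>
    rw [List.reverse_cons, List.append_assoc] at hz ⊢
    obtain ⟨h1, h2, h3⟩ := collapse_spec hs z L hi (Zigzag.of_append _ hz)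
    obtain ⟨ih1, ih2, ih3⟩ := ih _ h2 (h3 _ hz)
    refine ⟨?_, ih2, ih3⟩
    rw [scan, List.singleton_append, run_append_addGain (by rw [collapse_head?, List.head?_cons]) (by simp) h1, ih1,
      addGain_addGain, List.map_append, List.sum_append, mul_add, add_comm]

theorem collapse_nonneg (s₄ : ℝ) (L : List ℝ) : ∀ u ∈ (collapse s₄ L).1, 0 ≤ u := by
  fun_induction collapse s₄ L <;> simp_all

theorem scan_nonneg (l L : List ℝ) : ∀ u ∈ (scan L l).1, 0 ≤ u := by
  induction l generalizing L with
  | nil => simp [scan]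
  | cons z l ih =>
    intro u hu
    rcases List.mem_append.1 hu with hu | hu
    · exact collapse_nonneg z L u hu
    · exact ih _ u hu

/-! ### Ranges of the residue -/

/-- Sum of `h` over the ranges between consecutive points. -/
def rangeSum (h : ℝ → ℝ) : List ℝ → ℝ
  | a :: b :: l => h |a - b| + rangeSum h (b :: l)
  | _ => 0

theorem rises_add_falls {h : ℝ → ℝ} (h0 : h 0 = 0) :
    ∀ L, ((rises L).map h).sum + ((falls L).map h).sum = rangeSum h L
  | [] => by simp [rises, falls, rangeSum]
  | [_] => by simp [rises, falls, rangeSum]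
  | a :: b :: l => by
    have ih := rises_add_falls h0 (b :: l)
    rw [rangeSum, ← ih, rises, falls]
    rcases lt_trichotomy a b with hab | rfl | hab
    · rw [if_pos hab, if_neg hab.not_gt, abs_of_neg (by linarith), neg_sub, List.map_cons,
        List.sum_cons, add_assoc]
    · simp [h0]
    · rw [if_neg hab.not_gt, if_pos hab, abs_of_pos (by linarith), List.map_cons, List.sum_cons]
      ring

theorem rangeSum_append (h : ℝ → ℝ) (b : ℝ) (L' : List ℝ) :
    ∀ L, rangeSum h (L ++ b :: L') = rangeSum h (L ++ [b]) + rangeSum h (b :: L')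
  | [] => by simp [rangeSum]
  | [a] => by simp [rangeSum]
  | a :: c :: L => by
    have ih := rangeSum_append h b L' (c :: L)
    simp only [List.cons_append, rangeSum] at ih ⊢
    rw [ih, add_assoc]

theorem rangeSum_reverse (h : ℝ → ℝ) : ∀ L, rangeSum h L.reverse = rangeSum h L
  | [] => rfl
  | [_] => rfl
  | a :: b :: l => by
    have ih := rangeSum_reverse h (b :: l)
    rw [List.reverse_cons] at ih
    rw [List.reverse_cons, List.reverse_cons, List.append_assoc, List.singleton_append,
      rangeSum_append, ih, rangeSum, abs_sub_comm]
    simp only [rangeSum]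
    ring

theorem rises_nonneg : ∀ L, ∀ u ∈ rises L, 0 ≤ u
  | [] => by simp [rises]
  | [_] => by simp [rises]
  | a :: b :: l => by
    have ih := rises_nonneg (b :: l)
    rw [rises]
    split_ifs with hab
    · rintro u (_ | ⟨_, hu⟩)
      · linarith
      · exact ih u hu
    · exact ih

theorem falls_nonneg : ∀ L, ∀ u ∈ falls L, 0 ≤ u
  | [] => by simp [falls]
  | [_] => by simp [falls]
  | a :: b :: l => by
    have ih := falls_nonneg (b :: l)
    rw [falls]
    split_ifs with hab
    · rintro u (_ | ⟨_, hu⟩)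
      · linarith
      · exact ih u hu
    · exact ih

/-- State of the automaton after an upward move of size `u` of an irreducible zigzag; `first` says
that this move is larger than the one before it. -/
def Front (s : ℝ) (σ : StopState) (u : ℝ) (first : Prop) : Prop :=
  min u s ≤ σ.lo ∧ (first → σ.lo = s ∧ σ.hi = max (s - u) 0)

/-- While the ranges grow, the stop has full room `s` for the next move. Once they shrink, the last
move has left room `min v s`, and the next range is smaller than `v`. Either way the stop moves by
`min u s`. -/
theorem Front.step_down {σ : StopState} (hv : Valid s σ) {u v : ℝ} {first : Prop}
    (h : Front s σ v first) (hu : 0 ≤ u) (hor : first ∨ u < v) :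
    (step s (-u) σ).gain = σ.gain + min u s ∧ Front s (step s (-u) σ).swap u (v < u) := by
  obtain ⟨h1, h2⟩ := h
  rw [hv.step_neg, hv.swap.step_of_nonneg hu]
  simp only [swap, Front]
  have h3 := hv.hi_nonneg
  have h4 := hv.lo_le
  have h5 := hv.lo_nonneg
  have key : min u σ.lo = min u s := by
    rcases hor with h | h
    · rw [(h2 h).1]
    · grind
  rw [key]
  have h6 : min u s ≤ s := min_le_right _ _
  refine ⟨rfl, le_min (by linarith) h6, fun hvu => ?_⟩
  obtain ⟨h7, h8⟩ := h2 (hor.resolve_right hvu.not_gt)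
  rw [h7, h8]
  constructor <;> grind

theorem Front.step_up {σ : StopState} (hv : Valid s σ) {u v : ℝ} {first : Prop}
    (h : Front s σ.swap v first) (hu : 0 ≤ u) (hor : first ∨ u < v) :
    (step s u σ).gain = σ.gain + min u s ∧ Front s (step s u σ) u (v < u) := by
  have := h.step_down hv.swap hu hor
  rwa [hv.step_swap] at this

theorem front_first_up (hs : 0 ≤ s) {u : ℝ} (hu : 0 ≤ u) :
    (step s u (init s)).gain = min u s ∧ Front s (step s u (init s)) u True := by
  rw [(valid_init hs).step_of_nonneg hu]
  simp only [init, Front, zero_add, true_and]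
  have : 0 ≤ min u s := le_min hu hs
  grind

/-- Whether the newest range is larger than the previous one. -/
def NewestLarger : List ℝ → Prop
  | z :: q :: p :: _ => |q - p| < |z - q|
  | _ => True

/-- The two orientations of the newest range are carried together, the falling one seen through
`swap`, because each step of the induction exchanges them. -/
theorem run_residue (hs : 0 ≤ s) : ∀ (z q : ℝ) (l : List ℝ), Zigzag (z :: q :: l) →
    Irreducible (z :: q :: l) →
    (run s (z :: q :: l)).gain = rangeSum (fun u => min u s) (z :: q :: l) ∧
      (q < z → Front s (run s (z :: q :: l)) (z - q) (NewestLarger (z :: q :: l))) ∧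
      (z < q → Front s (run s (z :: q :: l)).swap (q - z) (NewestLarger (z :: q :: l)))
  | z, q, [], hz, _ => by
    simp only [run, rangeSum, NewestLarger, add_zero]
    rcases lt_or_gt_of_ne hz.ne with h | h
    · have := front_first_up hs (u := q - z) (by linarith)
      rw [abs_of_neg (by linarith), ← neg_sub q z, (valid_init hs).step_neg, neg_neg]
      exact ⟨this.1, fun h' => absurd h' h.not_gt, fun _ => this.2⟩
    · have := front_first_up hs (u := z - q) (by linarith)
      rw [abs_of_pos (by linarith)]
      exact ⟨this.1, fun _ => this.2, fun h' => absurd h' h.not_gt⟩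
  | z, q, p :: l, hz, hi => by
    obtain ⟨h1, h2, h3⟩ := run_residue hs q p l hz.2 hi.tail
    -- Irreducibility says that a range no larger than its predecessor is followed by a strictly
    -- smaller one: the ranges grow, then shrink.
    have hor : NewestLarger (q :: p :: l) ∨ |z - q| < |q - p| := by
      cases l with
      | nil => exact Or.inl trivial
      | cons o l =>
        by_contra! hc
        obtain ⟨hc1, hc2⟩ := hc
        have hc1 : ¬ |p - o| < |q - p| := hc1
        refine hi.1 ⟨?_, ?_⟩
        · rw [abs_sub_comm p q, abs_sub_comm o p]
          exact not_lt.1 hc1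
        · rwa [abs_sub_comm p q, abs_sub_comm q z]
    have hv := valid_run hs (q :: p :: l)
    rw [run, rangeSum, ← h1]
    simp only [NewestLarger]
    rcases hz.1 with h | h
    · rw [abs_of_pos (by linarith : 0 < q - p), abs_of_neg (by linarith : z - q < 0), neg_sub]
        at hor
      have := (h2 h.1).step_down hv (u := q - z) (by linarith) hor
      rw [neg_sub] at this
      rw [abs_of_pos (by linarith : 0 < q - p), abs_of_neg (by linarith : z - q < 0), neg_sub]
      exact ⟨by rw [this.1, add_comm], fun h' => absurd h' h.2.not_gt, fun _ => this.2⟩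
    · rw [abs_of_neg (by linarith : q - p < 0), abs_of_pos (by linarith : 0 < z - q), neg_sub]
        at hor
      have := (h3 h.1).step_up hv (u := z - q) (by linarith) hor
      rw [abs_of_neg (by linarith : q - p < 0), abs_of_pos (by linarith : 0 < z - q), neg_sub]
      exact ⟨by rw [this.1, add_comm], fun _ => this.2, fun h' => absurd h' h.2.not_gt⟩

/-! ### All half cycles of a profile -/

/-- Depths of all half cycles of a profile. -/
noncomputable def halfCycles (x : List ℝ) : List ℝ := (rainflow x).1 ++ (rainflow x).2

theorem lifeLoss_eq (Φ : ℝ → ℝ) (x : List ℝ) :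
    lifeLoss Φ x = ((halfCycles x).map fun u => Φ u / 2).sum := by
  rw [lifeLoss, halfCycles, List.map_append, List.sum_append]

theorem halfCycles_nonneg (x : List ℝ) : ∀ u ∈ halfCycles x, 0 ≤ u := by
  intro u hu
  simp only [halfCycles, rainflow, List.mem_append] at hu
  rcases hu with (h | h) | (h | h)
  · exact scan_nonneg _ _ u h
  · exact rises_nonneg _ u h
  · exact scan_nonneg _ _ u h
  · exact falls_nonneg _ u h

/-- The half cycles of depth `u` contribute `min u s` each to the variation of the stop of
width `s`. -/
theorem sum_min_halfCycles (hs : 0 ≤ s) (x : List ℝ) :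
    ((halfCycles x).map fun u => min u s).sum = (run s x.reverse).gain := by
  have e1 : run s (x.foldl pushSample []) = run s (x.reverse ++ []) :=
    run_foldl_pushSample hs x rfl rfl
  have hz : Zigzag ((localExtrema x).reverse ++ []) := by
    rw [localExtrema, List.reverse_reverse, List.append_nil]
    exact zigzag_foldl_pushSample x (L := []) trivial
  obtain ⟨h1, h2, h3⟩ := scan_spec hs (localExtrema x) [] trivial hz
  have e2 : (run s (scan [] (localExtrema x)).2).gain =
      rangeSum (fun u => min u s) (scan [] (localExtrema x)).2 := by
    generalize (scan [] (localExtrema x)).2 = L at h2 h3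
    match L, h2, h3 with
    | [], _, _ => rfl
    | [_], _, _ => rfl
    | z :: q :: l, h2, h3 => exact (run_residue hs z q l h3 h2).1
  have e3 := rises_add_falls (h := fun u => min u s) (min_eq_left hs)
    (scan [] (localExtrema x)).2.reverse
  rw [localExtrema, List.reverse_reverse, List.append_nil, ← localExtrema, e1, List.append_nil]
    at h1
  rw [h1, addGain, e2, ← rangeSum_reverse, ← e3]
  simp only [halfCycles, rainflow, List.map_append, List.sum_append]
  ring

end Storage

/-! ### Comparison of a profile with a greedy one -/

namespace StopState

variable {s : ℝ}

/-- The state after the first `t` moves of the profile `x`. -/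
noncomputable def track (s : ℝ) (x : ℕ → ℝ) : ℕ → StopState
  | 0 => init s
  | t + 1 => step s (x (t + 1) - x t) (track s x t)

theorem valid_track (hs : 0 ≤ s) (x : ℕ → ℝ) : ∀ t, Valid s (track s x t)
  | 0 => valid_init hs
  | t + 1 => (valid_track hs x t).step _

theorem run_reverse_map_range (x : ℕ → ℝ) :
    ∀ t, run s ((List.range (t + 1)).map x).reverse = track s x t
  | 0 => rfl
  | t + 1 => by
    have ih := run_reverse_map_range x t
    rw [List.range_succ, List.map_append, List.reverse_append] at ih ⊢
    rw [List.range_succ, List.map_append, List.reverse_append]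
    simp only [List.map_cons, List.map_nil, List.reverse_cons, List.reverse_nil, List.nil_append,
      List.cons_append, run, track] at ih ⊢
    rw [ih]

/-- A profile that stays in a window of width `s` is not affected by the stop of width `s`. -/
theorem gain_track_of_mem_Icc (hs : 0 ≤ s) {x : ℕ → ℝ} {l : ℝ} :
    ∀ t, (∀ i ≤ t, x i ∈ Set.Icc l (l + s)) →
      (track s x t).gain = ∑ i ∈ Finset.range t, |x (i + 1) - x i| ∧
        x t - l ≤ (track s x t).lo ∧ l + s - x t ≤ (track s x t).hi
  | 0, h => by
    have := h 0 le_rfl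
    simp only [track, init, Finset.range_zero, Finset.sum_empty, true_and]
    constructor <;> linarith [this.1, this.2]
  | t + 1, h => by
    obtain ⟨h1, h2, h3⟩ := gain_track_of_mem_Icc hs t fun i hi => h i (by omega)
    have hv := valid_track hs x t
    have h4 := h (t + 1) le_rfl
    have h5 := h t (by omega)
    rw [Finset.sum_range_succ, ← h1, track]
    rcases le_total (x t) (x (t + 1)) with hx | hx
    · rw [hv.step_of_nonneg_le (sub_nonneg.2 hx) (by linarith [h4.2]),
        abs_of_nonneg (sub_nonneg.2 hx)]
      exact ⟨rfl, le_min (by linarith) (by linarith [h4.2]), by dsimp only; linarith⟩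
    · rw [← neg_sub, hv.step_neg, hv.swap.step_of_nonneg_le (sub_nonneg.2 hx)
        (by simp only [swap]; linarith [h4.1]), abs_neg, abs_of_nonneg (sub_nonneg.2 hx)]
      exact ⟨rfl, by simp only [swap]; linarith,
        le_min (by simp only [swap]; linarith) (by linarith [h4.1])⟩

/-- The profile at `x` with state `ρ` is ahead of the profile at `y` with state `σ`, to which the
amount `w` is charged, both confined to `[l, h]`. -/
structure Ahead (s l h x y w : ℝ) (ρ σ : StopState) : Prop where
  -- A climb by `s - ρ.lo` gives the stop its full room `s` below. It fits under `h`, so reaching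
  -- the limit `h` restores that room.
  top : s - ρ.lo ≤ h - x
  bot : s - ρ.hi ≤ x - l
  gain : σ.gain ≤ ρ.gain + w
  lo : σ.gain + σ.lo ≤ ρ.gain + w + ρ.lo
  hi : σ.gain + σ.hi ≤ ρ.gain + w + ρ.hi
  -- Either the limits cannot halt the profile before its stop saturates, or the lead in variation
  -- covers the distance between the profiles.
  near : (ρ.hi ≤ h - x ∧ ρ.lo ≤ x - l) ∨
    (σ.gain + (x - y) ≤ ρ.gain + w ∧ σ.gain + (y - x) ≤ ρ.gain + w)

variable {l h x y w : ℝ} {ρ σ : StopState}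

theorem Ahead.swap (H : Ahead s l h x y w ρ σ) : Ahead s (-h) (-l) (-x) (-y) w ρ.swap σ.swap := by
  obtain ⟨h1, h2, h3, h4, h5, h6⟩ := H
  constructor <;> simp only [StopState.swap]
  · linarith
  · linarith
  · exact h3
  · exact h5
  · exact h4
  · refine h6.imp (fun h => ⟨?_, ?_⟩) (fun h => ⟨?_, ?_⟩) <;> linarith [h.1, h.2]

theorem ahead_init (hl : l ≤ x) (hh : x ≤ h) : Ahead s l h x x 0 (init s) (init s) := by
  constructor <;> simp [init, hl, hh]

/-- If the stop at `x` saturates, `hi` bounds what the other can gain. If `x` follows `r` in full,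
it moves at least as far as the other. If `x` is halted at `h` before saturation, the first
alternative of `near` is excluded, and the second pays for the other's climb to at most `h`. -/
theorem Ahead.step_up (H : Ahead s l h x y w ρ σ) (hρ : Valid s ρ) (hσ : Valid s σ) {r δ ε : ℝ} (hδ : 0 ≤ δ) (hδr : δ ≤ r) (hδh : y + δ ≤ h)
    (hε : 0 ≤ ε) (hεh : x + ε ≤ h) (hmax : ε = r ∨ x + ε = h ∨ ρ.hi ≤ ε) :
    Ahead s l h (x + ε) (y + δ) w (step s ε ρ) (step s δ σ) := by
  obtain ⟨h1, h2, h3, h4, h5, h6⟩ := H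
  obtain ⟨a1, a2, a3, a4, a5⟩ := id hρ
  obtain ⟨b1, b2, b3, b4, b5⟩ := id hσ
  rw [hσ.step_of_nonneg hδ]
  rcases le_or_gt ρ.hi ε with hle | hlt
  · rw [hρ.step_of_hi_le hle]
    constructor <;> grind
  · rw [hρ.step_of_nonneg_le hε hlt.le]
    have hmax : ε = r ∨ x + ε = h := by
      rcases hmax with h | h | h
      · exact Or.inl h
      · exact Or.inr h
      · linarith
    constructor <;> grind

/-- An unanswered move by `δ` raises the variation and the displacement by at most `δ` each, hence
the charge `2 * δ`. -/
theorem Ahead.extra_up (H : Ahead s l h x y w ρ σ) (hσ : Valid s σ) {δ : ℝ} (hδ : 0 ≤ δ) :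
    Ahead s l h x (y + δ) (w + 2 * δ) ρ (step s δ σ) := by
  obtain ⟨h1, h2, h3, h4, h5, h6⟩ := H
  obtain ⟨b1, b2, b3, b4, b5⟩ := id hσ
  rw [hσ.step_of_nonneg hδ]
  constructor <;> grind

theorem Ahead.extra (H : Ahead s l h x y w ρ σ) (hσ : Valid s σ) (δ : ℝ) :
    Ahead s l h x (y + δ) (w + 2 * |δ|) ρ (StopState.step s δ σ) := by
  rcases le_total 0 δ with hδ | hδ
  · rw [abs_of_nonneg hδ]
    exact H.extra_up hσ hδ
  · have := (H.swap.extra_up hσ.swap (neg_nonneg.2 hδ)).swap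
    rw [hσ.step_swap] at this
    rw [abs_of_nonpos hδ]
    simpa only [swap_swap, neg_neg, neg_add_rev, add_comm] using this

/-- One interval with an upward instruction `r`, followed greedily by `x`. -/
theorem Ahead.step_of_nonneg (H : Ahead s l h x y w ρ σ) (hρ : Valid s ρ) (hσ : Valid s σ)
    (hyh : y ≤ h) {r δ ε : ℝ} (hr : 0 ≤ r) (hδh : y + δ ≤ h)
    (hε : 0 ≤ ε) (hεh : x + ε ≤ h) (hmax : ε = r ∨ x + ε = h ∨ ρ.hi ≤ ε) :
    Ahead s l h (x + ε) (y + δ) (w + (|r - δ| + |δ| - |r|)) (StopState.step s ε ρ)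
      (StopState.step s δ σ) := by
  -- Wrong-way motion is charged as an extra after standing still, over-response as an extra after
  -- exactly `r`; both excesses equal twice the extra.
  rcases le_total δ 0 with hδ | hδ
  · have := (H.step_up hρ hσ le_rfl hr (by linarith) hε hεh hmax).extra (hσ.step 0) δ
    rw [add_zero, hσ.step_zero] at this
    convert this using 1
    rw [abs_of_nonneg hr, abs_of_nonpos hδ, abs_of_nonneg (by linarith)]
    ring
  · rcases le_total δ r with hδr | hδr
    · convert H.step_up hρ hσ hδ hδr hδh hε hεh hmax using 1
      rw [abs_of_nonneg hr, abs_of_nonneg hδ, abs_of_nonneg (by linarith)]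
      ring
    · have := (H.step_up hρ hσ hr le_rfl (by linarith) hε hεh hmax).extra (hσ.step r)
        (δ - r)
      rw [← hσ.step_add_of_nonneg hr (by linarith), add_sub_cancel, add_assoc,
        add_sub_cancel] at this
      convert this using 1
      rw [abs_of_nonneg hr, abs_of_nonneg hδ, abs_of_nonneg (by linarith : 0 ≤ δ - r),
        abs_of_nonpos (by linarith)]
      ring

theorem Ahead.step_of_nonpos (H : Ahead s l h x y w ρ σ) (hρ : Valid s ρ) (hσ : Valid s σ)
    (hly : l ≤ y) {r δ ε : ℝ} (hr : r ≤ 0) (hδl : l ≤ y + δ)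
    (hε : ε ≤ 0) (hεl : l ≤ x + ε) (hmax : ε = r ∨ x + ε = l ∨ ρ.lo ≤ -ε) :
    Ahead s l h (x + ε) (y + δ) (w + (|r - δ| + |δ| - |r|)) (StopState.step s ε ρ)
      (StopState.step s δ σ) := by
  have := (H.swap.step_of_nonneg hρ.swap hσ.swap (r := -r) (δ := -δ) (ε := -ε) (by linarith)
    (by linarith) (by linarith) (by linarith) (by linarith) (by
      rcases hmax with h | h | h
      · exact Or.inl (by rw [h])
      · exact Or.inr (Or.inl (by linarith))
      · exact Or.inr (Or.inr h))).swap
  rw [hρ.step_swap, hσ.step_swap, swap_swap, swap_swap, ← neg_add, ← neg_add] at this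
  simp only [neg_neg, abs_neg] at this
  rwa [← neg_sub', abs_neg] at this

end StopState

/-! ### Weak majorization -/

/-- By concavity every slope to the left of `b` is at least the slope `m` from `b` to `a`. -/
theorem ConcaveOn.monotoneOn_sub_last_slope {g : ℝ → ℝ} {a b c m : ℝ}
    (hg : ConcaveOn ℝ (Set.Icc 0 c) g) (hb : 0 ≤ b) (hba : b < a) (hac : a ≤ c)
    (hm : m * (a - b) = g a - g b) : MonotoneOn (fun x => g x - m * x) (Set.Icc 0 b) := by
  have key : ∀ x ∈ Set.Icc 0 b, m * (b - x) ≤ g b - g x := by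
    intro x hx
    rcases hx.2.eq_or_lt with rfl | hxb
    · simp
    · have := hg.slope_anti_adjacent ⟨hx.1, by linarith⟩ ⟨by linarith, hac⟩ hxb hba
      rw [← hm, mul_div_assoc, div_self (sub_pos.2 hba).ne', mul_one,
        le_div_iff₀ (sub_pos.2 hxb)] at this
      exact this
  intro x hx y hy hxy
  rcases hxy.eq_or_lt with rfl | hlt
  · exact le_rfl
  · have h1 := hg.slope_anti_adjacent ⟨hx.1, by linarith [hy.2]⟩ ⟨by linarith, hac⟩ hlt
      (hy.2.trans_lt hba)
    have h2 := key y hy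
    have h3 : m ≤ (g a - g y) / (a - y) := by
      rw [le_div_iff₀ (by linarith [hy.2])]
      linarith
    have h4 := h3.trans h1
    rw [le_div_iff₀ (sub_pos.2 hlt)] at h4
    dsimp only
    linarith

/-- If the truncated sums of `u` are at most those of `v`, up to an excess `W`, then so are the sums
of a concave monotone function whose slope at `0` is at most `q`, up to an excess `q * W`. -/
theorem sum_map_le_of_sum_min_le {W : ℝ} (hW : 0 ≤ W) (S : Finset ℝ) :
    ∀ (g : ℝ → ℝ) (c q : ℝ) (u v : List ℝ), ConcaveOn ℝ (Set.Icc 0 c) g →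
      MonotoneOn g (Set.Icc 0 c) → g 0 = 0 → 0 ≤ q → (∀ a ∈ Set.Icc 0 c, g a ≤ q * a) →
      (∀ a ∈ S, 0 < a ∧ a ≤ c) → (∀ a ∈ u, a = 0 ∨ a ∈ S) → (∀ a ∈ v, a = 0 ∨ a ∈ S) →
      (∀ s ∈ Set.Icc 0 c, (u.map fun a => min a s).sum ≤ (v.map fun a => min a s).sum + W) →
      (u.map g).sum ≤ (v.map g).sum + q * W := by
  induction S using Finset.induction_on_max with
  | empty =>
    intro g c q u v _ _ g0 hq _ _ hu hv _
    have zero : ∀ L : List ℝ, (∀ a ∈ L, a = 0 ∨ a ∈ (∅ : Finset ℝ)) → (L.map g).sum = 0 := by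
      intro L hL
      refine List.sum_eq_zero fun a ha => ?_
      obtain ⟨b, hb, rfl⟩ := List.mem_map.1 ha
      obtain rfl : b = 0 := by simpa using hL b hb
      exact g0
    rw [zero u hu, zero v hv, zero_add]
    exact mul_nonneg hq hW
  | insert a S hmax ih =>
    intro g c q u v hg hmono g0 hq hgq hS hu hv hsum
    obtain ⟨ha0, hac⟩ := hS a (Finset.mem_insert_self a S)
    -- The next depth below `a`, or `0` if there is none.
    obtain ⟨b, hbS, hb⟩ := Finset.exists_max_image (insert 0 S) id ⟨0, Finset.mem_insert_self 0 S⟩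
    have hb0 : 0 ≤ b := hb 0 (Finset.mem_insert_self 0 S)
    have hSb : ∀ x ∈ S, x ≤ b := fun x hx => hb x (Finset.mem_insert_of_mem hx)
    have hbS' : b = 0 ∨ b ∈ S := Finset.mem_insert.1 hbS
    have hba : b < a := by
      rcases hbS' with rfl | h
      · exact ha0
      · exact hmax b h
    have hab : 0 < a - b := sub_pos.2 hba
    set m : ℝ := (g a - g b) / (a - b) with hm_def
    have hm : m * (a - b) = g a - g b := div_mul_cancel₀ _ hab.ne'
    have hm0 : 0 ≤ m :=
      div_nonneg (sub_nonneg.2 (hmono ⟨hb0, by linarith⟩ ⟨ha0.le, hac⟩ hba.le)) hab.le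
    have hsub : Set.Icc 0 b ⊆ Set.Icc 0 c := Set.Icc_subset_Icc_right (by linarith)
    have hgm : MonotoneOn (fun x => g x - m * x) (Set.Icc 0 b) :=
      hg.monotoneOn_sub_last_slope hb0 hba hac hm
    have hgc : ConcaveOn ℝ (Set.Icc 0 b) (fun x => g x - m * x) :=
      (hg.subset hsub (convex_Icc 0 b)).sub ((convexOn_id (convex_Icc 0 b)).smul hm0)
    -- Concavity and `g 0 = 0` give `g b ≥ (b / a) * g a`, so `g a - g b ≤ (1 - b / a) * q * a`.
    -- Hence the bound `q - m` left for the remainder is nonnegative.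
    have hmq : m ≤ q := by
      have h0 : 0 ≤ 1 - b / a := by
        rw [sub_nonneg, div_le_one ha0]
        exact hba.le
      have h1 := hg.2 (show (0 : ℝ) ∈ Set.Icc 0 c from ⟨le_rfl, by linarith⟩)
        (show a ∈ Set.Icc 0 c from ⟨ha0.le, hac⟩) h0 (show 0 ≤ b / a by positivity) (by ring)
      simp only [smul_eq_mul, g0, mul_zero, zero_add, div_mul_cancel₀ b ha0.ne'] at h1
      have h2 := hgq a ⟨ha0.le, hac⟩
      rw [hm_def, div_le_iff₀ hab]
      have h3 : (1 - b / a) * g a ≤ (1 - b / a) * (q * a) :=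
        mul_le_mul_of_nonneg_left h2 h0
      have h4 : (1 - b / a) * (q * a) = q * (a - b) := by
        field_simp
      linarith
    have hgq' : ∀ x ∈ Set.Icc 0 b, g x - m * x ≤ (q - m) * x := by
      intro x hx
      linarith [hgq x (hsub hx)]
    have mem : ∀ L : List ℝ, (∀ x ∈ L, x = 0 ∨ x ∈ insert a S) →
        ∀ x ∈ L.map fun x => min x b, x = 0 ∨ x ∈ S := by
      intro L hL x hx
      obtain ⟨y, hy, rfl⟩ := List.mem_map.1 hx
      rcases hL y hy with rfl | h
      · exact Or.inl (min_eq_left hb0)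
      · rcases Finset.mem_insert.1 h with rfl | h
        · rw [min_eq_right hba.le]
          exact hbS'
        · rw [min_eq_left (hSb y h)]
          exact Or.inr h
    -- At the depths that occur, `g` is `m * min · a` plus a function of `min · b`: one truncation
    -- is peeled off, and the remainder no longer involves `a`.
    have split : ∀ L : List ℝ, (∀ x ∈ L, x = 0 ∨ x ∈ insert a S) →
        (L.map g).sum = ((L.map fun x => min x b).map fun x => g x - m * x).sum +
          m * (L.map fun x => min x a).sum := by
      intro L hL
      rw [List.map_map, ← List.sum_map_mul_left, ← List.sum_map_add]
      congr 1
      refine List.map_congr_left fun y hy => ?_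
      simp only [Function.comp]
      rcases hL y hy with rfl | h
      · rw [min_eq_left hb0, min_eq_left ha0.le]
        ring
      · rcases Finset.mem_insert.1 h with rfl | h
        · rw [min_eq_right hba.le, min_self]
          linarith
        · rw [min_eq_left (hSb y h), min_eq_left (hmax y h).le]
          ring
    have main := ih (fun x => g x - m * x) b (q - m) (u.map fun x => min x b)
      (v.map fun x => min x b) hgc hgm (by simp [g0]) (sub_nonneg.2 hmq) hgq'
      (fun x hx => ⟨(hS x (Finset.mem_insert_of_mem hx)).1, hSb x hx⟩) (mem u hu) (mem v hv) (by
        intro s hs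
        simp only [List.map_map, Function.comp_def, min_assoc, min_eq_right hs.2]
        exact hsum s (hsub hs))
    have last := mul_le_mul_of_nonneg_left (hsum a ⟨ha0.le, hac⟩) hm0
    rw [split u hu, split v hv]
    linarith

/-! ### From stop variation to life loss -/

namespace Storage

open StopState

/-- The half-cycle depths add up to the total variation of the profile. -/
theorem sum_halfCycles (x : ℕ → ℝ) (T : ℕ) :
    (halfCycles ((List.range (T + 1)).map x)).sum =
      ∑ t ∈ Finset.range T, |x (t + 1) - x t| := by
  set H := halfCycles ((List.range (T + 1)).map x)
  obtain ⟨K, hK⟩ : ∃ K, ∀ u ∈ H, u ≤ K := by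
    obtain ⟨K, hK⟩ := H.toFinset.bddAbove
    exact ⟨K, fun u hu => hK (by simpa using hu)⟩
  obtain ⟨M, hM⟩ : ∃ M, ∀ i ≤ T, |x i| ≤ M := by
    obtain ⟨M, hM⟩ := ((Finset.range (T + 1)).image fun i => |x i|).bddAbove
    exact ⟨M, fun i hi => hM (by
      simpa using ⟨i, hi, rfl⟩)⟩
  have hM0 : 0 ≤ M := (abs_nonneg _).trans (hM 0 (Nat.zero_le T))
  -- A width so large that no depth is truncated and the stop never meets its window.
  have hs : 0 ≤ max K (2 * M) := le_max_of_le_right (by linarith)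
  have h1 := sum_min_halfCycles hs ((List.range (T + 1)).map x)
  rw [run_reverse_map_range, (gain_track_of_mem_Icc hs (l := -M) T fun i hi => ?_).1] at h1
  · rw [← h1]
    congr 1
    conv_lhs => rw [← List.map_id H]
    exact List.map_congr_left fun u hu => (min_eq_left (le_max_of_le_left (hK u hu))).symm
  · have := abs_le.1 (hM i hi)
    exact ⟨this.1, by linarith [le_max_right K (2 * M)]⟩

/-- The half cycles of a profile with range at most `w` have depth at most `w`. -/
theorem halfCycles_le {x : ℕ → ℝ} {T : ℕ} {l w : ℝ} (hw : 0 ≤ w)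
    (hx : ∀ i ≤ T, x i ∈ Set.Icc l (l + w)) :
    ∀ u ∈ halfCycles ((List.range (T + 1)).map x), u ≤ w := by
  have h1 := sum_min_halfCycles hw ((List.range (T + 1)).map x)
  rw [run_reverse_map_range, (gain_track_of_mem_Icc hw T hx).1, ← sum_halfCycles] at h1
  by_contra! hc
  obtain ⟨u, hu, hlt⟩ := hc
  -- At width `w` truncation leaves the sum of the depths unchanged, so no depth can exceed `w`.
  have h2 := List.sum_lt_sum (l := halfCycles ((List.range (T + 1)).map x)) (fun u => min u w) id
    (fun u _ => min_le_left u w) ⟨u, hu, by simpa using hlt⟩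
  rw [h1, List.map_id] at h2
  exact h2.false

/-- The tangent at `p` supports a convex function on `[0, ∞)`. -/
theorem tangent_le {Φ : ℝ → ℝ} (hconv : ConvexOn ℝ (Set.Ici 0) Φ)
    (hdiff : DifferentiableOn ℝ Φ (Set.Ici 0)) {p u : ℝ} (hp : 0 ≤ p) (hu : 0 ≤ u) :
    Φ p + derivWithin Φ (Set.Ici 0) p * (u - p) ≤ Φ u := by
  rcases lt_trichotomy u p with h | rfl | h
  · have := hconv.slope_le_derivWithin hu hp h (hdiff p hp)
    rw [slope_def_field, div_le_iff₀ (sub_pos.2 h)] at this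
    linarith
  · simp
  · have := hconv.derivWithin_le_slope hp hu h (hdiff p hp)
    rw [slope_def_field, le_div_iff₀ (sub_pos.2 h)] at this
    linarith

/-- Comparison of the life losses of two profiles, each less the value of its variation at the
marginal price that makes half cycles of depth `p` optimal. -/
theorem lifeLoss_sub_le {Φ : ℝ → ℝ} (hΦ0 : Φ 0 = 0) (hmono : MonotoneOn Φ (Set.Ici 0))
    (hconv : ConvexOn ℝ (Set.Ici 0) Φ) (hdiff : DifferentiableOn ℝ Φ (Set.Ici 0)) {p q : ℝ}
    (hp : 0 ≤ p) (hq0 : 0 ≤ q) (hq : derivWithin Φ (Set.Ici 0) p = 2 * q) {x y : ℕ → ℝ} {T : ℕ}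
    {l W : ℝ} (hW : 0 ≤ W) (hx : ∀ i ≤ T, x i ∈ Set.Icc l (l + p))
    (hxy : ∀ s ∈ Set.Icc 0 p, (track s y T).gain ≤ (track s x T).gain + W) :
    lifeLoss Φ ((List.range (T + 1)).map x) - q * ∑ t ∈ Finset.range T, |x (t + 1) - x t| ≤
      lifeLoss Φ ((List.range (T + 1)).map y) - q * ∑ t ∈ Finset.range T, |y (t + 1) - y t| +
        q * W := by
  have key : ∀ z : ℕ → ℝ, lifeLoss Φ ((List.range (T + 1)).map z) -
      q * ∑ t ∈ Finset.range T, |z (t + 1) - z t| =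
      -((halfCycles ((List.range (T + 1)).map z)).map fun u => q * u - Φ u / 2).sum := by
    intro z
    have h : lifeLoss Φ ((List.range (T + 1)).map z) +
        ((halfCycles ((List.range (T + 1)).map z)).map fun u => q * u - Φ u / 2).sum =
        q * (halfCycles ((List.range (T + 1)).map z)).sum := by
      rw [lifeLoss_eq, ← List.sum_map_add]
      simp only [add_sub_cancel]
      rw [List.sum_map_mul_left, List.map_id']
    rw [← sum_halfCycles]
    linarith
  rw [key, key]
  have hxp := halfCycles_le hp hx
  have hx0 := halfCycles_nonneg ((List.range (T + 1)).map x)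
  have hy0 := halfCycles_nonneg ((List.range (T + 1)).map y)
  have hxs : ∀ s ∈ Set.Icc 0 p, ((halfCycles ((List.range (T + 1)).map x)).map fun u => min u s).sum
      = (track s x T).gain := fun s hs => by
    rw [sum_min_halfCycles hs.1, run_reverse_map_range]
  have hys : ∀ s ∈ Set.Icc 0 p, ((halfCycles ((List.range (T + 1)).map y)).map fun u => min u s).sum
      = (track s y T).gain := fun s hs => by
    rw [sum_min_halfCycles hs.1, run_reverse_map_range]
  generalize halfCycles ((List.range (T + 1)).map x) = v at *
  generalize halfCycles ((List.range (T + 1)).map y) = u at *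
  set g : ℝ → ℝ := fun u => q * u - Φ u / 2 with hg
  have tan : ∀ {a b : ℝ}, 0 ≤ a → 0 ≤ b → Φ a + derivWithin Φ (Set.Ici 0) a * (b - a) ≤ Φ b :=
    fun ha hb => tangent_le hconv hdiff ha hb
  have hgmax : ∀ {a : ℝ}, 0 ≤ a → g a ≤ g p := fun {a} ha => by
    have := tan hp ha
    rw [hq] at this
    simp only [hg]
    linarith
  have hsub : Set.Icc 0 p ⊆ Set.Ici (0 : ℝ) := fun a ha => ha.1
  have hgconc : ConcaveOn ℝ (Set.Icc 0 p) g := by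
    refine ConcaveOn.sub ((concaveOn_id (convex_Icc 0 p)).smul hq0) ?_
    have := (hconv.subset hsub (convex_Icc 0 p)).smul (show (0 : ℝ) ≤ 1 / 2 by norm_num)
    simpa only [smul_eq_mul, one_div, inv_mul_eq_div] using this
  have hgmono : MonotoneOn g (Set.Icc 0 p) := by
    intro a ha b hb hab
    have h1 := tan hb.1 ha.1
    have h2 : derivWithin Φ (Set.Ici 0) b ≤ 2 * q := by
      rw [← hq]
      exact hconv.monotoneOn_derivWithin hdiff hb.1 hp hb.2
    have h3 := mul_le_mul_of_nonneg_right h2 (sub_nonneg.2 hab)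
    simp only [hg]
    linarith
  -- Beyond `p` the function `g` lies below `g p`, so cutting the depths of `y` at `p` cannot lower
  -- the sum.
  have hmin : (u.map g).sum ≤ ((u.map fun a => min a p).map g).sum := by
    rw [List.map_map]
    refine List.sum_le_sum fun a ha => ?_
    rcases le_total a p with h | h
    · rw [Function.comp, min_eq_left h]
    · rw [Function.comp, min_eq_right h]
      exact hgmax (hy0 a ha)
  have mem : ∀ L : List ℝ, (∀ a ∈ L, a ∈ u.map (fun a => min a p) ∨ a ∈ v) → ∀ a ∈ L, a = 0 ∨
      a ∈ ((u.map fun a => min a p).toFinset ∪ v.toFinset).erase 0 := by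
    intro L hL a ha
    by_cases h0 : a = 0
    · exact Or.inl h0
    · refine Or.inr (Finset.mem_erase.2 ⟨h0, ?_⟩)
      rw [Finset.mem_union, List.mem_toFinset, List.mem_toFinset]
      exact hL a ha
  have main := sum_map_le_of_sum_min_le hW
    (((u.map fun a => min a p).toFinset ∪ v.toFinset).erase 0) g p q (u.map fun a => min a p) v
    hgconc hgmono (by simp [hg, hΦ0]) hq0 (fun a ha => by
      have := hmono (Set.self_mem_Ici) ha.1 ha.1
      rw [hΦ0] at this
      simp only [hg]
      linarith) (by
      intro a ha
      rw [Finset.mem_erase, Finset.mem_union, List.mem_toFinset, List.mem_toFinset] at ha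
      obtain ⟨ha0, ha⟩ := ha
      rcases ha with ha | ha
      · obtain ⟨b, hb, rfl⟩ := List.mem_map.1 ha
        exact ⟨lt_of_le_of_ne (le_min (hy0 b hb) hp) (Ne.symm ha0), min_le_right b p⟩
      · exact ⟨lt_of_le_of_ne (hx0 a ha) (Ne.symm ha0), hxp a ha⟩)
    (mem _ fun a ha => Or.inl ha) (mem _ fun a ha => Or.inr ha) (by
      intro s hs
      simp only [List.map_map, Function.comp_def, min_assoc, min_eq_right hs.2]
      rw [hxs s hs, hys s hs]
      exact hxy s hs)
  linarith

end Storage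

/-! ### The threshold policy -/

namespace Storage

open StopState

namespace Model

variable {m : Model}

/-- The change of the state of charge that the instruction `r` asks for. -/
noncomputable def asked (m : Model) (r : ℝ) : ℝ :=
  if 0 ≤ r then m.τ * m.ηc / m.E * r else m.τ / (m.ηd * m.E) * r

theorem asked_nonneg (hτ : 0 < m.τ) (hE : 0 < m.E) (hηc : 0 < m.ηc) {r : ℝ} (hr : 0 ≤ r) :
    0 ≤ m.asked r := by
  rw [asked, if_pos hr]
  positivity

theorem asked_neg (hτ : 0 < m.τ) (hE : 0 < m.E) (hηd : 0 < m.ηd) {r : ℝ} (hr : r < 0) :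
    m.asked r < 0 := by
  rw [asked, if_neg hr.not_ge]
  exact mul_neg_of_pos_of_neg (by positivity) hr

theorem uhat_spec (h : m.marginal ∈ derivWithin m.Φ (Set.Ici 0) '' Set.Ici 0) :
    0 ≤ m.uhat ∧ derivWithin m.Φ (Set.Ici 0) m.uhat = m.marginal :=
  ⟨Function.invFunOn_mem h, Function.invFunOn_eq h⟩

theorem soc_policy (r : ℕ → ℝ) : ∀ t, m.soc (m.policyC r) (m.policyD r) t = (m.controller r t).x
  | 0 => rfl
  | t + 1 => by
    rw [soc, soc_policy r t]
    rfl

theorem step_action_of_nonneg (hτ : 0 < m.τ) (hE : 0 < m.E) (hηc : 0 < m.ηc)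
    (s : ControllerState) {r : ℝ} (hr : 0 ≤ r) :
    m.step s.x (m.action s r).1 (m.action s r).2 =
      s.x + min (min m.xhi (s.xmin + m.uhat) - s.x) (m.asked r) := by
  rw [action, if_pos hr, step, asked, if_pos hr, mul_zero, sub_zero,
    mul_min_of_nonneg _ _ (by positivity : 0 ≤ m.τ * m.ηc / m.E)]
  congr 2
  field_simp

theorem step_action_of_neg (hτ : 0 < m.τ) (hE : 0 < m.E) (hηd : 0 < m.ηd)
    (s : ControllerState) {r : ℝ} (hr : r < 0) :
    m.step s.x (m.action s r).1 (m.action s r).2 =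
      s.x - min (s.x - max m.xlo (s.xmax - m.uhat)) (-m.asked r) := by
  rw [action, if_neg hr.not_ge, step, asked, if_neg hr.not_ge, mul_zero, add_zero,
    mul_min_of_nonneg _ _ (by positivity : 0 ≤ m.τ / (m.ηd * m.E)), mul_neg]
  congr 2
  field_simp

/-- The constraints satisfied by all reachable states of the controller. -/
structure ControllerState.Reachable (m : Model) (s : ControllerState) : Prop where
  xlo_le : m.xlo ≤ s.xmin
  xmin_le : s.xmin ≤ s.x
  le_xmax : s.x ≤ s.xmax
  xmax_le : s.xmax ≤ m.xhi
  range_le : s.xmax ≤ s.xmin + m.uhat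

theorem reachable_controller (hτ : 0 < m.τ) (hE : 0 < m.E) (hηc : 0 < m.ηc) (hηd : 0 < m.ηd)
    (hlo : m.xlo ≤ m.x₀) (hhi : m.x₀ ≤ m.xhi) (hu : 0 ≤ m.uhat) (r : ℕ → ℝ) :
    ∀ t, (m.controller r t).Reachable m
  | 0 => ⟨hlo, le_rfl, le_rfl, hhi, by simpa [controller] using hu⟩
  | t + 1 => by
    obtain ⟨h1, h2, h3, h4, h5⟩ := reachable_controller hτ hE hηc hηd hlo hhi hu r t
    simp only [controller]
    rcases le_or_gt 0 (r t) with hr | hr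
    · rw [step_action_of_nonneg hτ hE hηc _ hr]
      have := asked_nonneg hτ hE hηc hr
      constructor <;> dsimp only <;> grind
    · rw [step_action_of_neg hτ hE hηd _ hr]
      have := asked_neg hτ hE hηd hr
      constructor <;> dsimp only <;> grind

theorem controller_mem_Icc (r : ℕ → ℝ) : ∀ t, ∀ i ≤ t,
    (m.controller r i).x ∈ Set.Icc (m.controller r t).xmin (m.controller r t).xmax
  | 0, i, hi => by
    obtain rfl : i = 0 := by omega
    exact ⟨le_rfl, le_rfl⟩
  | t + 1, i, hi => by
    rcases Nat.le_succ_iff.1 hi with hi | rfl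
    · have := controller_mem_Icc r t i hi
      exact ⟨(min_le_left _ _).trans this.1, this.2.trans (le_max_left _ _)⟩
    · exact ⟨min_le_right _ _, le_max_right _ _⟩

/-! ### The policy seen by the stops -/

/-- The stop of width `s ≤ û` never leaves more room than the thresholds of the policy. -/
theorem track_controller_le (hτ : 0 < m.τ) (hE : 0 < m.E) (hηc : 0 < m.ηc) (hηd : 0 < m.ηd)
    (hlo : m.xlo ≤ m.x₀) (hhi : m.x₀ ≤ m.xhi) (r : ℕ → ℝ) {s : ℝ} (hs : s ∈ Set.Icc 0 m.uhat) :
    ∀ t, (track s (fun i => (m.controller r i).x) t).hi ≤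
        (m.controller r t).xmin + m.uhat - (m.controller r t).x ∧
      (track s (fun i => (m.controller r i).x) t).lo ≤
        (m.controller r t).x - (m.controller r t).xmax + m.uhat
  | 0 => by simpa [track, init, controller] using hs.2
  | t + 1 => by
    obtain ⟨ih1, ih2⟩ := track_controller_le hτ hE hηc hηd hlo hhi r hs t
    obtain ⟨h1, h2, h3, h4, h5⟩ :=
      reachable_controller hτ hE hηc hηd hlo hhi (hs.1.trans hs.2) r t
    have hv := valid_track hs.1 (fun i => (m.controller r i).x) t
    obtain ⟨v1, v2, v3, v4, v5⟩ := id hv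
    have hs2 := hs.2
    simp only [track, controller]
    rcases le_or_gt 0 (r t) with hr | hr
    · rw [step_action_of_nonneg hτ hE hηc _ hr, add_sub_cancel_left]
      have := asked_nonneg hτ hE hηc hr
      rw [hv.step_of_nonneg (le_min (by grind) this)]
      constructor <;> dsimp only <;> grind
    · rw [step_action_of_neg hτ hE hηd _ hr, sub_sub_cancel_left]
      have := asked_neg hτ hE hηd hr
      rw [hv.step_neg, hv.swap.step_of_nonneg (le_min (by grind) (by linarith))]
      simp only [StopState.swap]
      constructor <;> grind

/-- At every width `s ≤ û` the policy is ahead of every other profile within the limits. -/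
theorem ahead_controller (hτ : 0 < m.τ) (hE : 0 < m.E) (hηc : 0 < m.ηc) (hηd : 0 < m.ηd)
    (hlo : m.xlo ≤ m.x₀) (hhi : m.x₀ ≤ m.xhi) (r : ℕ → ℝ) {s : ℝ} (hs : s ∈ Set.Icc 0 m.uhat)
    {y : ℕ → ℝ} (hy0 : y 0 = m.x₀) :
    ∀ t, (∀ i ≤ t, y i ∈ Set.Icc m.xlo m.xhi) →
      Ahead s m.xlo m.xhi (m.controller r t).x (y t)
        (∑ i ∈ Finset.range t, (|m.asked (r i) - (y (i + 1) - y i)| + |y (i + 1) - y i|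
          - |m.asked (r i)|))
        (track s (fun i => (m.controller r i).x) t) (track s y t)
  | 0, _ => by
    rw [hy0]
    exact ahead_init hlo hhi
  | t + 1, hy => by
    have H := ahead_controller hτ hE hηc hηd hlo hhi r hs hy0 t fun i hi => hy i (by omega)
    obtain ⟨ih1, ih2⟩ := track_controller_le hτ hE hηc hηd hlo hhi r hs t
    obtain ⟨h1, h2, h3, h4, h5⟩ :=
      reachable_controller hτ hE hηc hηd hlo hhi (hs.1.trans hs.2) r t
    have hv := valid_track hs.1 (fun i => (m.controller r i).x) t
    have hv' := valid_track hs.1 y t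
    have hyt := hy t (by omega)
    have hyt' := hy (t + 1) le_rfl
    rw [Finset.sum_range_succ, track, track]
    simp only [controller]
    rcases le_or_gt 0 (r t) with hr | hr
    · rw [step_action_of_nonneg hτ hE hηc _ hr, add_sub_cancel_left]
      have ha := asked_nonneg hτ hE hηc hr
      -- The move of the policy is the change asked for, the distance to `xhi`, or the distance to
      -- the threshold; in the last case `ih1` shows that the stop saturates.
      have := H.step_of_nonneg hv hv' hyt.2 ha (δ := y (t + 1) - y t)
        (ε := min (min m.xhi ((m.controller r t).xmin + m.uhat) - (m.controller r t).x)
          (m.asked (r t))) (by linarith [hyt'.2]) (le_min (by grind) ha) (by grind) (by grind)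
      rwa [add_sub_cancel] at this
    · rw [step_action_of_neg hτ hE hηd _ hr, sub_sub_cancel_left]
      have ha := asked_neg hτ hE hηd hr
      have := H.step_of_nonpos hv hv' hyt.1 ha.le (δ := y (t + 1) - y t)
        (ε := -min ((m.controller r t).x - max m.xlo ((m.controller r t).xmax - m.uhat))
          (-m.asked (r t))) (by linarith [hyt'.1])
        (neg_nonpos.2 (le_min (by grind) (by linarith))) (by grind) (by grind)
      rwa [add_sub_cancel, ← sub_eq_add_neg] at this

/-- The policy moves in the direction asked for and never further, so its excess vanishes. -/
theorem abs_asked_sub_controller (hτ : 0 < m.τ) (hE : 0 < m.E) (hηc : 0 < m.ηc) (hηd : 0 < m.ηd)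
    (hlo : m.xlo ≤ m.x₀) (hhi : m.x₀ ≤ m.xhi) (hu : 0 ≤ m.uhat) (r : ℕ → ℝ) (t : ℕ) :
    |m.asked (r t) - ((m.controller r (t + 1)).x - (m.controller r t).x)| =
      |m.asked (r t)| - |(m.controller r (t + 1)).x - (m.controller r t).x| := by
  obtain ⟨h1, h2, h3, h4, h5⟩ := reachable_controller hτ hE hηc hηd hlo hhi hu r t
  simp only [controller]
  rcases le_or_gt 0 (r t) with hr | hr
  · rw [step_action_of_nonneg hτ hE hηc _ hr, add_sub_cancel_left]
    have ha := asked_nonneg hτ hE hηc hr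
    rw [abs_of_nonneg ha, abs_of_nonneg (le_min (by grind) ha),
      abs_of_nonneg (sub_nonneg.2 (min_le_right _ _))]
  · rw [step_action_of_neg hτ hE hηd _ hr, sub_sub_cancel_left]
    have ha := asked_neg hτ hE hηd hr
    have h0 : 0 ≤ min ((m.controller r t).x - max m.xlo ((m.controller r t).xmax - m.uhat))
        (-m.asked (r t)) := le_min (by grind) (by linarith)
    rw [abs_of_neg ha, abs_neg, abs_of_nonneg h0, abs_of_nonpos (by grind)]
    ring

theorem policy_feasibleWithin (hτ : 0 < m.τ) (hE : 0 < m.E) (hηc : 0 < m.ηc) (hηd : 0 < m.ηd)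
    (hlo : m.xlo ≤ m.x₀) (hhi : m.x₀ ≤ m.xhi) (hu : 0 ≤ m.uhat) {T : ℕ} {r : ℕ → ℝ}
    (hr : ∀ t < T, |r t| ≤ m.P) : m.FeasibleWithin T r (m.policyC r) (m.policyD r) := by
  have hc : ∀ t, 0 ≤ m.policyC r t ∧ m.policyC r t ≤ max (r t) 0 ∧
      0 ≤ m.policyD r t ∧ m.policyD r t ≤ max (-r t) 0 := by
    intro t
    obtain ⟨h1, h2, h3, h4, h5⟩ := reachable_controller hτ hE hηc hηd hlo hhi hu r t
    rw [policyC, policyD, action]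
    split_ifs with h
    · refine ⟨le_min (mul_nonneg (by positivity) (by grind)) h, ?_, le_rfl, le_max_right _ _⟩
      exact (min_le_right _ _).trans (le_max_left _ _)
    · refine ⟨le_rfl, le_max_right _ _, le_min (mul_nonneg (by positivity) (by grind))
        (by linarith), ?_⟩
      exact (min_le_right _ _).trans (le_max_left _ _)
  refine ⟨fun t ht => ?_, fun t _ => ⟨(hc t).2.1, (hc t).2.2.2⟩⟩
  obtain ⟨c0, c1, d0, d1⟩ := hc t
  obtain ⟨h1, h2, h3, h4, h5⟩ := reachable_controller hτ hE hηc hηd hlo hhi hu r (t + 1)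
  have := abs_le.1 (hr t ht)
  rw [soc_policy]
  refine ⟨⟨c0, c1.trans (max_le this.2 ?_)⟩, ⟨d0, d1.trans (max_le ?_ ?_)⟩, ?_, ?_⟩ <;> linarith

/-! ### Penalties and total cost -/

/-- Per unit of state of charge, a charging shortfall costs `E * θ / ηc` and a discharging shortfall
`E * π * ηd`; the price condition equates the two. -/
theorem penalty_of_within (hτ : 0 < m.τ) (hE : 0 < m.E) (hηc : 0 < m.ηc) (hηd : 0 < m.ηd)
    (h : m.π * m.ηd = m.θ / m.ηc) {r c d : ℝ} (hc0 : 0 ≤ c) (hd0 : 0 ≤ d)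
    (hc : c ≤ max r 0) (hd : d ≤ max (-r) 0) (x : ℝ) :
    m.penalty r c d = m.E * (m.π * m.ηd) * |m.asked r - (m.step x c d - x)| := by
  rw [penalty, asked, step]
  have hθ : m.θ = m.π * m.ηd * m.ηc := by
    rw [h, div_mul_cancel₀ _ hηc.ne']
  split_ifs with hr
  · rw [max_eq_right (by linarith)] at hd
    rw [max_eq_left hr] at hc
    obtain rfl : d = 0 := le_antisymm hd hd0
    have e : m.τ * m.ηc / m.E * r - (x + m.τ * m.ηc / m.E * c - m.τ / (m.ηd * m.E) * 0 - x) =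
        m.τ * m.ηc / m.E * (r - c) := by ring
    rw [e, abs_of_nonneg (mul_nonneg (by positivity) (by linarith)), max_eq_left (by linarith),
      max_eq_right (by linarith), hθ]
    field_simp
    ring
  · rw [max_eq_right (by linarith)] at hc
    rw [max_eq_left (by linarith)] at hd
    obtain rfl : c = 0 := le_antisymm hc hc0
    have e : m.τ / (m.ηd * m.E) * r - (x + m.τ * m.ηc / m.E * 0 - m.τ / (m.ηd * m.E) * d - x) =
        -(m.τ / (m.ηd * m.E) * (-r - d)) := by ring
    rw [e, abs_neg, abs_of_nonneg (mul_nonneg (by positivity) (by linarith)),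
      max_eq_right (by linarith), max_eq_left (by linarith)]
    field_simp
    ring

/-- With `ηd = 1 / ηc` the change of the state of charge depends on `c - d` alone, and with `θ = π`
the penalty is proportional to `|r - (c - d)|`, so over-response and simultaneous charging and
discharging are covered. -/
theorem penalty_of_equal (hE : 0 < m.E) (hτ : 0 < m.τ) (hηc : 0 < m.ηc)
    (hη : m.ηd = 1 / m.ηc) (hθπ : m.θ = m.π) (r c d x : ℝ) :
    m.penalty r c d = m.E * (m.π * m.ηd) * |m.asked r - (m.step x c d - x)| := by
  have ha : m.asked r = m.τ * m.ηc / m.E * r := by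
    rw [asked, hη]
    split_ifs
    · rfl
    · field_simp
  have e : m.asked r - (m.step x c d - x) = m.τ * m.ηc / m.E * (r - (c - d)) := by
    rw [ha, step, hη]
    field_simp
    ring
  have hmax : max (r - (c - d)) 0 + max ((c - d) - r) 0 = |r - (c - d)| := by
    rw [← neg_sub r (c - d)]
    exact max_zero_add_max_neg_zero_eq_abs_self _
  rw [e, abs_mul, abs_of_pos (by positivity : 0 < m.τ * m.ηc / m.E), penalty, hθπ, ← mul_add,
    hmax, hη]
  field_simp

theorem cost_eq {T : ℕ} {r c d : ℕ → ℝ}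
    (h : ∀ t < T, m.penalty (r t) (c t) (d t) = m.E * (m.π * m.ηd) *
      |m.asked (r t) - (m.soc c d (t + 1) - m.soc c d t)|) :
    m.cost T r c d = m.E * (m.π * m.ηd) *
        ∑ t ∈ Finset.range T, |m.asked (r t) - (m.soc c d (t + 1) - m.soc c d t)| +
      lifeLoss m.Φ ((List.range (T + 1)).map (m.soc c d)) * m.B * m.E := by
  rw [cost, Finset.mul_sum]
  congr 1
  exact Finset.sum_congr rfl fun t ht => h t (Finset.mem_range.1 ht)

/-- The policy costs no more than any feasible response whose penalties are proportional to the
distance between the change of the state of charge and the change asked for. -/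
theorem policyCost_le (hτ : 0 < m.τ) (hE : 0 < m.E) (hηc : 0 < m.ηc) (hηd : 0 < m.ηd)
    (hB : 0 < m.B) (hπ : 0 ≤ m.π) (hlo : m.xlo ≤ m.x₀) (hhi : m.x₀ ≤ m.xhi) (hΦ0 : m.Φ 0 = 0)
    (hΦmono : MonotoneOn m.Φ (Set.Ici 0)) (hΦconv : ConvexOn ℝ (Set.Ici 0) m.Φ)
    (hΦdiff : DifferentiableOn ℝ m.Φ (Set.Ici 0))
    (hû : m.marginal ∈ derivWithin m.Φ (Set.Ici 0) '' Set.Ici 0) {T : ℕ} {r : ℕ → ℝ}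
    (hr : ∀ t < T, |r t| ≤ m.P) (hprice : m.π * m.ηd = m.θ / m.ηc) {c d : ℕ → ℝ}
    (hfeas : m.Feasible T c d)
    (hpen : ∀ t < T, m.penalty (r t) (c t) (d t) = m.E * (m.π * m.ηd) *
      |m.asked (r t) - (m.soc c d (t + 1) - m.soc c d t)|) :
    m.policyCost T r ≤ m.cost T r c d := by
  obtain ⟨hu, hmarg⟩ := uhat_spec hû
  set q := m.π * m.ηd / m.B with hq_def
  have hq0 : 0 ≤ q := by positivity
  have hqB : m.π * m.ηd = q * m.B := (div_mul_cancel₀ _ hB.ne').symm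
  -- The two summands of `marginal` coincide by `hprice`.
  have hq : derivWithin m.Φ (Set.Ici 0) m.uhat = 2 * q := by
    rw [hmarg, marginal, ← hprice, hq_def]
    ring
  have hpol := policy_feasibleWithin hτ hE hηc hηd hlo hhi hu hr
  have hy : ∀ i ≤ T, m.soc c d i ∈ Set.Icc m.xlo m.xhi := by
    intro i hi
    cases i with
    | zero => exact ⟨hlo, hhi⟩
    | succ i => exact (hfeas i hi).2.2
  have hx : ∀ i ≤ T, (m.controller r i).x ∈
      Set.Icc (m.controller r T).xmin ((m.controller r T).xmin + m.uhat) := by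
    intro i hi
    have h1 := controller_mem_Icc (m := m) r T i hi
    have h2 := reachable_controller hτ hE hηc hηd hlo hhi hu r T
    exact ⟨h1.1, h1.2.trans h2.range_le⟩
  have main := lifeLoss_sub_le hΦ0 hΦmono hΦconv hΦdiff hu hq0 hq (y := m.soc c d) (T := T)
    (Finset.sum_nonneg fun i _ => sub_nonneg.2 ?_) hx
    fun s hs => (ahead_controller hτ hE hηc hηd hlo hhi r hs rfl T hy).gain
  · rw [policyCost, cost_eq hpen, cost_eq fun t ht => ?_]
    · have e : m.soc (m.policyC r) (m.policyD r) = fun i => (m.controller r i).x :=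
        funext (soc_policy r)
      rw [e]
      simp only [abs_asked_sub_controller hτ hE hηc hηd hlo hhi hu r]
      rw [Finset.sum_sub_distrib] at main ⊢
      rw [Finset.sum_add_distrib] at main
      rw [hqB]
      have hBE : 0 < m.B * m.E := by positivity
      have := mul_le_mul_of_nonneg_right main hBE.le
      linarith
    · obtain ⟨h1, h2, -⟩ := hpol.1 t ht
      obtain ⟨h3, h4⟩ := hpol.2 t ht
      exact penalty_of_within hτ hE hηc hηd hprice h1.1 h2.1 h3 h4 _
  · have := abs_sub_abs_le_abs_sub (m.asked (r i)) (m.soc c d (i + 1) - m.soc c d i)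
    linarith

end Model

end Storage

/-- If `π η_d = θ / η_c`, the threshold policy is feasible and attains the offline optimum. If the
efficiencies and the prices are equal, this is the case, and the policy is then optimal even among
the responses that are allowed to exceed the instruction signal. -/
theorem corollary1 (m : Storage.Model)
    (hτ : 0 < m.τ) (hE : 0 < m.E) (hηc : 0 < m.ηc) (hηd : 0 < m.ηd) (hB : 0 < m.B)
    (hθ : 0 ≤ m.θ) (hπ : 0 ≤ m.π)
    (hlo : m.xlo ≤ m.x₀) (hhi : m.x₀ ≤ m.xhi)
    (hΦ0 : m.Φ 0 = 0)
    (hΦmono : MonotoneOn m.Φ (Set.Ici 0))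
    (hΦconv : StrictConvexOn ℝ (Set.Ici 0) m.Φ)
    (hΦdiff : DifferentiableOn ℝ m.Φ (Set.Ici 0))
    (hû : m.marginal ∈ derivWithin m.Φ (Set.Ici 0) '' Set.Ici 0)
    (T : ℕ) (r : ℕ → ℝ) (hr : ∀ t < T, |r t| ≤ m.P) :
    (m.π * m.ηd = m.θ / m.ηc →
      m.FeasibleWithin T r (m.policyC r) (m.policyD r) ∧
      IsLeast (m.costsWithin T r) (m.policyCost T r) ∧
      m.policyCost T r = m.offlineCost T r) ∧
    (m.ηd = 1 / m.ηc → m.θ = m.π →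
      m.π * m.ηd = m.θ / m.ηc ∧
      IsLeast (m.costs T r) (m.policyCost T r) ∧
      m.policyCost T r = sInf (m.costs T r)) := by
  have hpol := Storage.Model.policy_feasibleWithin hτ hE hηc hηd hlo hhi
    (Storage.Model.uhat_spec hû).1 hr
  constructor
  · intro h
    have hleast : IsLeast (m.costsWithin T r) (m.policyCost T r) := by
      refine ⟨⟨_, _, hpol, rfl⟩, ?_⟩
      rintro _ ⟨c, d, hcd, rfl⟩
      refine Storage.Model.policyCost_le hτ hE hηc hηd hB hπ hlo hhi hΦ0 hΦmono hΦconv.convexOn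
        hΦdiff hû hr h hcd.1 fun t ht => ?_
      obtain ⟨h1, h2, -⟩ := hcd.1 t ht
      obtain ⟨h3, h4⟩ := hcd.2 t ht
      exact Storage.Model.penalty_of_within hτ hE hηc hηd h h1.1 h2.1 h3 h4 _
    exact ⟨hpol, hleast, hleast.csInf_eq.symm⟩
  · intro hη hθπ
    have h : m.π * m.ηd = m.θ / m.ηc := by
      rw [hη, hθπ, mul_one_div]
    have hleast : IsLeast (m.costs T r) (m.policyCost T r) := by
      refine ⟨⟨_, _, hpol.1, rfl⟩, ?_⟩
      rintro _ ⟨c, d, hcd, rfl⟩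
      exact Storage.Model.policyCost_le hτ hE hηc hηd hB hπ hlo hhi hΦ0 hΦmono hΦconv.convexOn
        hΦdiff hû hr h hcd fun t _ =>
          Storage.Model.penalty_of_equal hE hτ hηc hη hθπ _ _ _ _
    exact ⟨h, hleast, hleast.csInf_eq.symm⟩
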